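/- Let $S$ be a scheme, let $G$ be a group scheme over $S$ with multiplication $m\colon G\times_S G\to G$, and let $F$ be a sheaf of Abelian groups (written multiplicatively) on the big fppf site $S_{\mathrm{fppf}}$. Assume that $F$ is representable by a scheme that is fppf and affine over $S$. For an $S$-scheme $X$ write $F_X$ for the trivial $F$-torsor on $X$; for $F$-torsors write $T\otimes T'$ for the contracted product and $T^\vee$ for the dual (the same sheaf with the inverse action of $F$). Write $p_0,p_1\colon G^2\to G$ for the projections, and $p_{0,1}=\mathrm{id}\times p_0$, $p_{1,2}=p_1\times\mathrm{id}$, $m_{0,1}=m\times\mathrm{id}$, $m_{1,2}=\mathrm{id}\times m$ for the indicated morphisms $G^3\to G^2$. For an $F$-torsor $T$ on $G$ and an $F$-torsor $P$ on $G^2$ put \[ \delta^1T=p_1^*T\otimes(m^*T)^\vee\otimes p_0^*T,\qquad \delta^2P=p_{1,2}^*P\otimes(m_{0,1}^*P)^\vee\otimes m_{1,2}^*P\otimes(p_{0,1}^*P)^\vee . \] Let $\kappa_T\colon F_{G^3}\xrightarrow{\sim}\delta^2\delta^1T$ be the canonical trivialisation: over a point $(a,b,c)$ of $G^3$ it sends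 $1$ to \[ (t_c\otimes t_{bc}^\vee\otimes t_b)\otimes(t_c\otimes t_{abc}^\vee\otimes t_{ab})^\vee\otimes(t_{bc}\otimes t_{abc}^\vee\otimes t_a)\otimes(t_b\otimes t_{ab}^\vee\otimes t_a)^\vee \] for arbitrary local sections $t_g$ of $T$ over the points $g\in\{a,b,c,ab,bc,abc\}$ of $G$ (this does not depend on their choice). An $F$-extension datum on $G$ is a pair $(T,\tau)$ where $T$ is an $F$-torsor on $G$ and $\tau\colon F_{G^2}\xrightarrow{\sim}\delta^1T$ is an isomorphism of $F$-torsors on $G^2$ such that the composition of the canonical isomorphism $F_{G^3}\xrightarrow{\sim}\delta^2F_{G^2}$ with $\delta^2\tau$ equals $\kappa_T$. An isomorphism $(T,\tau)\to(T',\tau')$ is an isomorphism $\phi\colon T\xrightarrow{\sim}T'$ of $F$-torsors with $\delta^1\phi\circ\tau=\tau'$. Let $\mathcal E(G,F)$ be the groupoid of $F$-extension data on $G$. A central extension of $G$ by $F$ is an exact sequence $1\to F\xrightarrow{j}E\xrightarrow{q}G\to1$ of sheaves of groups on $S_{\mathrm{fppf}}$ with $j(F)$ central in $E$; morphisms of central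 extensions are the homomorphisms $E\to E'$ compatible with $j$ and $q$. Then there is a canonical equivalence of categories between $\mathcal E(G,F)$ and the category of central extensions of $G$ by $F$. More precisely, there is an equivalence under which, naturally in $(T,\tau)$, the extension $E$ corresponding to $(T,\tau)$ is identified with $T$ as an $F$-torsor on $G$ (where $F$ acts on $E$ through multiplication by $j$ and $E$ lies over $G$ via $q$), in such a way that $\tau$ is the trivialisation defined by the group law of $E$: for all sections $x,y$ of $E$ over an $S$-scheme $U$, $\tau$ sends $1$ over the point $(q(x),q(y))$ of $G^2$ to $y\otimes(xy)^\vee\otimes x$. -/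

import Mathlib

universe w u

open CategoryTheory Opposite MonoidalCategory CartesianMonoidalCategory MonObj

noncomputable section

namespace ExtData

section Presheaf

variable {C : Type (u + 1)} [Category.{u} C] {J : GrothendieckTopology C}

theorem presheaf_map_id (P : Cᵒᵖ ⥤ Type w) {U : C} (t : P.obj (op U)) :
    P.map (𝟙 U).op t = t := by
  simp

theorem presheaf_map_map (P : Cᵒᵖ ⥤ Type w) {U V W : C} (g : V ⟶ U) (h : W ⟶ V)
    (t : P.obj (op U)) : P.map h.op (P.map g.op t) = P.map (h ≫ g).op t := by
  simp

theorem sheaf_sep {P : Cᵒᵖ ⥤ Type w} (hP : Presheaf.IsSheaf J P) {U : C} {R : Sieve U}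
    (hR : R ∈ J U) {x y : P.obj (op U)}
    (h : ∀ ⦃V : C⦄ (g : V ⟶ U), R g → P.map g.op x = P.map g.op y) : x = y :=
  (hP.isSheafFor R hR).isSeparatedFor.ext fun _ g hg => h g hg

/-- Gluing sections that are characterised by a property: a property of sections of a sheaf over
objects over `U` that is stable under restriction, has at most one solution over each object, and
has a solution locally, comes from a section over `U`. -/
theorem sheaf_glue {P : Cᵒᵖ ⥤ Type w} (hP : Presheaf.IsSheaf J P) {U : C} {R : Sieve U}
    (hR : R ∈ J U) (p : ∀ ⦃V : C⦄ (_ : V ⟶ U), P.obj (op V) → Prop)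
    (hres : ∀ ⦃V W : C⦄ (g : V ⟶ U) (h : W ⟶ V) (t : P.obj (op V)),
      p g t → p (h ≫ g) (P.map h.op t))
    (huniq : ∀ ⦃V : C⦄ (g : V ⟶ U) (t t' : P.obj (op V)), R g → p g t → p g t' → t = t')
    (hex : ∀ ⦃V : C⦄ (g : V ⟶ U), R g → ∃ t, p g t) :
    ∃ t : P.obj (op U), ∀ ⦃V : C⦄ (g : V ⟶ U), R g → p g (P.map g.op t) := by
  choose x hx using hex
  have hc : Presieve.FamilyOfElements.SieveCompatible (P := P) (S := R) (fun V g hg => x g hg) := by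
    intro V W g h hg
    exact huniq _ _ _ (R.downward_closed hg h) (hx _ _) (hres _ _ _ (hx _ _))
  obtain ⟨t, ht, -⟩ := hP.isSheafFor R hR _ ((Presieve.compatible_iff_sieveCompatible _).2 hc)
  refine ⟨t, fun V g hg => ?_⟩
  rw [ht g hg]
  exact hx g hg

theorem isSheaf_of_sep_glue {P : Cᵒᵖ ⥤ Type w}
    (sep : ∀ ⦃U : C⦄ (R : Sieve U), R ∈ J U → ∀ x y : P.obj (op U),
      (∀ ⦃V : C⦄ (g : V ⟶ U), R g → P.map g.op x = P.map g.op y) → x = y)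
    (glue : ∀ ⦃U : C⦄ (R : Sieve U), R ∈ J U → ∀ x : (∀ ⦃V : C⦄ (g : V ⟶ U), R g → P.obj (op V)),
      (∀ ⦃V W : C⦄ (g : V ⟶ U) (h : W ⟶ V) (hg : R g),
        x (h ≫ g) (R.downward_closed hg h) = P.map h.op (x g hg)) →
      ∃ t : P.obj (op U), ∀ ⦃V : C⦄ (g : V ⟶ U) (hg : R g), P.map g.op t = x g hg) :
    Presheaf.IsSheaf J P := by
  rw [isSheaf_iff_isSheaf_of_type]
  intro U R hR x hx
  rw [Presieve.compatible_iff_sieveCompatible] at hx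
  obtain ⟨t, ht⟩ := glue R hR (fun V g hg => x g hg) (fun V W g h hg => hx g h hg)
  refine ⟨t, fun V g hg => ht g hg, fun y hy => sep R hR _ _ fun V g hg => ?_⟩
  rw [ht g hg]
  exact hy g hg

theorem sheaf_glue_family {P : Cᵒᵖ ⥤ Type w} (hP : Presheaf.IsSheaf J P) {U : C} {R : Sieve U}
    (hR : R ∈ J U) (x : ∀ ⦃V : C⦄ (g : V ⟶ U), R g → P.obj (op V))
    (hx : ∀ ⦃V W : C⦄ (g : V ⟶ U) (h : W ⟶ V) (hg : R g),
        x (h ≫ g) (R.downward_closed hg h) = P.map h.op (x g hg)) :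
    ∃ t : P.obj (op U), ∀ ⦃V : C⦄ (g : V ⟶ U) (hg : R g), P.map g.op t = x g hg := by
  obtain ⟨t, ht, -⟩ := hP.isSheafFor R hR (fun V g hg => x g hg)
    ((Presieve.compatible_iff_sieveCompatible _).2 (fun V W g h hg => hx g h hg))
  exact ⟨t, fun V g hg => ht g hg⟩

theorem isSheaf_yoneda [J.Subcanonical] (X : C) : Presheaf.IsSheaf J (yoneda.obj X) :=
  (isSheaf_iff_isSheaf_of_type _ _).2
    (GrothendieckTopology.Subcanonical.isSheaf_of_isRepresentable _)

end Presheaf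

variable {C : Type (u + 1)} [Category.{u} C] {J : GrothendieckTopology C}

/-- The sheaf of sets underlying a sheaf of abelian groups. -/
abbrev underlying (F : Sheaf J CommGrpCat.{u + 1}) : Sheaf J (Type (u + 1)) :=
  (sheafCompose J (forget CommGrpCat.{u + 1})).obj F

/-- An `F`-torsor over an object `X` of the site: a sheaf over `X` (the total space of the sheaf on
the localised site over `X`; a section over `p : U ⟶ X` is an element of `sheaf U` lying over `p`)
with an action of `F` that is simply transitive on the fibres, having sections locally on `X`. -/
structure Torsor (F : Sheaf J CommGrpCat.{u + 1}) (X : C) where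
  sheaf : Sheaf J (Type (u + 1))
  proj : ∀ {U : C}, sheaf.obj.obj (op U) → (U ⟶ X)
  smul : ∀ {U : C}, F.obj.obj (op U) → sheaf.obj.obj (op U) → sheaf.obj.obj (op U)
  proj_map : ∀ {U V : C} (g : V ⟶ U) (t : sheaf.obj.obj (op U)),
    proj (sheaf.obj.map g.op t) = g ≫ proj t
  smul_map : ∀ {U V : C} (g : V ⟶ U) (f : F.obj.obj (op U)) (t : sheaf.obj.obj (op U)),
    sheaf.obj.map g.op (smul f t) = smul (F.obj.map g.op f) (sheaf.obj.map g.op t)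
  proj_smul : ∀ {U : C} (f : F.obj.obj (op U)) (t : sheaf.obj.obj (op U)),
    proj (smul f t) = proj t
  one_smul : ∀ {U : C} (t : sheaf.obj.obj (op U)), smul 1 t = t
  mul_smul : ∀ {U : C} (f f' : F.obj.obj (op U)) (t : sheaf.obj.obj (op U)),
    smul (f * f') t = smul f (smul f' t)
  simply_transitive : ∀ {U : C} (t t' : sheaf.obj.obj (op U)), proj t = proj t' →
    ∃! f : F.obj.obj (op U), smul f t = t'
  locally_nonempty : ∀ {U : C} (x : U ⟶ X), ∃ R ∈ J U, ∀ ⦃V : C⦄ (g : V ⟶ U), R g →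
    ∃ t : sheaf.obj.obj (op V), proj t = g ≫ x

namespace Torsor

variable {F : Sheaf J CommGrpCat.{u + 1}} {X Y : C}

/-- Sections over `U` of the total space of a torsor. -/
def sec (T : Torsor F X) (U : C) : Type (u + 1) := T.sheaf.obj.obj (op U)

/-- The point of `X` over which a section lies. -/
def pr (T : Torsor F X) {U : C} (t : T.sec U) : U ⟶ X := T.proj t

/-- Restriction of sections. -/
def res (T : Torsor F X) {U V : C} (g : V ⟶ U) (t : T.sec U) : T.sec V := T.sheaf.obj.map g.op t

instance (T : Torsor F X) (U : C) : MulAction (F.obj.obj (op U)) (T.sec U) where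
  smul := T.smul
  one_smul := T.one_smul
  mul_smul := T.mul_smul

section
variable (T : Torsor F X) {U V W : C}

@[simp] theorem res_id (t : T.sec U) : T.res (𝟙 U) t = t :=
  presheaf_map_id T.sheaf.obj t

theorem res_res (g : V ⟶ U) (h : W ⟶ V) (t : T.sec U) :
    T.res h (T.res g t) = T.res (h ≫ g) t :=
  presheaf_map_map T.sheaf.obj g h t

@[simp] theorem pr_res (g : V ⟶ U) (t : T.sec U) : T.pr (T.res g t) = g ≫ T.pr t :=
  T.proj_map g t

@[simp] theorem pr_smul (f : F.obj.obj (op U)) (t : T.sec U) : T.pr (f • t) = T.pr t :=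
  T.proj_smul f t

theorem res_smul (g : V ⟶ U) (f : F.obj.obj (op U)) (t : T.sec U) :
    T.res g (f • t) = (F.obj.map g.op f : F.obj.obj (op V)) • T.res g t :=
  T.smul_map g f t

theorem exists_smul {t t' : T.sec U} (h : T.pr t = T.pr t') :
    ∃ f : F.obj.obj (op U), f • t = t' := (T.simply_transitive t t' h).exists

theorem smul_inj {t : T.sec U} {f f' : F.obj.obj (op U)} (h : f • t = f' • t) : f = f' :=
  (T.simply_transitive t (f' • t) (T.pr_smul f' t).symm).unique h rfl

theorem sep {R : Sieve U} (hR : R ∈ J U) {x y : T.sec U}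
    (h : ∀ ⦃V : C⦄ (g : V ⟶ U), R g → T.res g x = T.res g y) : x = y :=
  sheaf_sep T.sheaf.property hR h

theorem glue {R : Sieve U} (hR : R ∈ J U) (p : ∀ ⦃V : C⦄ (_ : V ⟶ U), T.sec V → Prop)
    (hres : ∀ ⦃V W : C⦄ (g : V ⟶ U) (h : W ⟶ V) (t : T.sec V), p g t → p (h ≫ g) (T.res h t))
    (huniq : ∀ ⦃V : C⦄ (g : V ⟶ U) (t t' : T.sec V), R g → p g t → p g t' → t = t')
    (hex : ∀ ⦃V : C⦄ (g : V ⟶ U), R g → ∃ t, p g t) :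
    ∃ t : T.sec U, ∀ ⦃V : C⦄ (g : V ⟶ U), R g → p g (T.res g t) :=
  sheaf_glue T.sheaf.property hR p hres huniq hex

theorem glue_family {R : Sieve U} (hR : R ∈ J U) (x : ∀ ⦃V : C⦄ (g : V ⟶ U), R g → T.sec V)
    (hx : ∀ ⦃V W : C⦄ (g : V ⟶ U) (h : W ⟶ V) (hg : R g),
        x (h ≫ g) (R.downward_closed hg h) = T.res h (x g hg)) :
    ∃ t : T.sec U, ∀ ⦃V : C⦄ (g : V ⟶ U) (hg : R g), T.res g t = x g hg :=
  sheaf_glue_family T.sheaf.property hR x hx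

theorem local_sec (x : U ⟶ X) : ∃ R ∈ J U, ∀ ⦃V : C⦄ (g : V ⟶ U), R g →
    ∃ t : T.sec V, T.pr t = g ≫ x := T.locally_nonempty x

end

/-- Morphisms of `F`-torsors over `X`: `F`-equivariant morphisms of sheaves over `X`. -/
@[ext] structure Hom (T T' : Torsor F X) where
  hom : T.sheaf ⟶ T'.sheaf
  proj_hom : ∀ {U : C} (t : T.sheaf.obj.obj (op U)), T'.proj (hom.hom.app (op U) t) = T.proj t
  smul_hom : ∀ {U : C} (f : F.obj.obj (op U)) (t : T.sheaf.obj.obj (op U)),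
    hom.hom.app (op U) (T.smul f t) = T'.smul f (hom.hom.app (op U) t)

instance : Category (Torsor F X) where
  Hom := Hom
  id T := ⟨𝟙 _, fun _ => rfl, fun _ _ => rfl⟩
  comp φ ψ := ⟨φ.hom ≫ ψ.hom,
    fun t => (ψ.proj_hom _).trans (φ.proj_hom t),
    fun f t => (congrArg _ (φ.smul_hom f t)).trans (ψ.smul_hom f _)⟩

/-- The action of a morphism of torsors on sections. -/
def app {T T' : Torsor F X} (φ : T ⟶ T') {U : C} (t : T.sec U) : T'.sec U :=
  (Hom.hom φ).hom.app (op U) t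

section
variable {T T' T'' : Torsor F X} {U V : C}

@[simp] theorem app_id (t : T.sec U) : app (𝟙 T) t = t := rfl

@[simp] theorem app_comp (φ : T ⟶ T') (ψ : T' ⟶ T'') (t : T.sec U) :
    app (φ ≫ ψ) t = app ψ (app φ t) := rfl

@[simp] theorem pr_app (φ : T ⟶ T') (t : T.sec U) : T'.pr (app φ t) = T.pr t :=
  Hom.proj_hom φ t

@[simp] theorem app_smul (φ : T ⟶ T') (f : F.obj.obj (op U)) (t : T.sec U) :
    app φ (f • t) = f • app φ t := Hom.smul_hom φ f t

theorem res_app (φ : T ⟶ T') (g : V ⟶ U) (t : T.sec U) :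
    T'.res g (app φ t) = app φ (T.res g t) :=
  (NatTrans.naturality_apply (Hom.hom φ).hom g.op t).symm

theorem hom_ext {φ ψ : T ⟶ T'} (h : ∀ (U : C) (t : T.sec U), app φ t = app ψ t) : φ = ψ := by
  apply Hom.ext
  apply Sheaf.hom_ext
  ext U t
  exact h U.unop t

/-- A morphism of torsors from its action on sections. -/
def mkHom (a : ∀ {U : C}, T.sec U → T'.sec U)
    (hres : ∀ {U V : C} (g : V ⟶ U) (t : T.sec U), T'.res g (a t) = a (T.res g t))
    (hpr : ∀ {U : C} (t : T.sec U), T'.pr (a t) = T.pr t)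
    (hsmul : ∀ {U : C} (f : F.obj.obj (op U)) (t : T.sec U), a (f • t) = f • a t) : T ⟶ T' :=
  Hom.mk ⟨{ app := fun U => ↾(fun t => a (U := U.unop) t)
            naturality := fun U V g => by
              ext t
              exact (hres g.unop t).symm }⟩ hpr hsmul

@[simp] theorem app_mkHom (a : ∀ {U : C}, T.sec U → T'.sec U) (hres hpr hsmul) (t : T.sec U) :
    app (mkHom (T := T) (T' := T') a hres hpr hsmul) t = a t := rfl

theorem app_bijective (φ : T ⟶ T') (U : C) (t' : T'.sec U) : ∃! t : T.sec U, app φ t = t' := by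
  have inj : ∀ {V : C} (s t : T.sec V), app φ s = app φ t → s = t := by
    intro V s t h
    obtain ⟨f, rfl⟩ := T.exists_smul (t := s) (t' := t)
      (by rw [← pr_app φ s, h, pr_app])
    rw [app_smul] at h
    have h1 : (1 : F.obj.obj (op V)) = f := T'.smul_inj ((MulAction.one_smul _).trans h)
    rw [← h1, MulAction.one_smul]
  obtain ⟨R, hR, hx⟩ := T.local_sec (T'.pr t')
  obtain ⟨t, ht⟩ := T.glue hR
    (fun V g t => app φ t = T'.res g t')
    (fun V W g h t ht => by
      rw [← res_app, ht, res_res])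
    (fun V g t t' _ h h' => inj _ _ (h.trans h'.symm))
    (fun V g hg => by
      obtain ⟨t, ht⟩ := hx g hg
      obtain ⟨f, hf⟩ := T'.exists_smul (t := app φ t) (t' := T'.res g t') (by simp [ht])
      exact ⟨f • t, by rw [app_smul, hf]⟩)
  refine ⟨t, T'.sep hR fun V g hg => ?_, fun s hs => ?_⟩
  · rw [res_app]
    exact ht g hg
  · refine T.sep hR fun V g hg => inj _ _ ?_
    rw [← res_app, hs]
    exact (ht g hg).symm

/-- Every morphism of torsors is an isomorphism. -/
theorem isIso_hom (φ : T ⟶ T') : IsIso φ := by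
  choose b hb hb' using app_bijective φ
  have hbb : ∀ {U : C} (t : T.sec U), b U (app φ t) = t := fun t => (hb' _ _ t rfl).symm
  refine ⟨mkHom (fun {U} t => b U t) ?_ ?_ ?_, ?_, ?_⟩
  · intro U V g t
    apply hb'
    rw [← res_app]
    exact congrArg _ (hb U t)
  · intro U t
    rw [← pr_app φ]
    exact congrArg _ (hb U t)
  · intro U f t
    refine (hb' _ _ _ ?_).symm
    change app φ (f • b U t) = _
    rw [app_smul]
    exact congrArg _ (hb U t)
  · exact hom_ext fun U t => hbb t
  · exact hom_ext fun U t => hb U t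

end

end Torsor

section Coefficients

variable (F : Sheaf J CommGrpCat.{u + 1}) {U V W : C}

theorem coeff_map_id (f : F.obj.obj (op U)) : F.obj.map (𝟙 U).op f = f := by
  simp

theorem coeff_map_map (g : V ⟶ U) (h : W ⟶ V) (f : F.obj.obj (op U)) :
    F.obj.map h.op (F.obj.map g.op f) = F.obj.map (h ≫ g).op f := by
  simp

theorem coeff_sep {R : Sieve U} (hR : R ∈ J U) {x y : F.obj.obj (op U)}
    (h : ∀ ⦃V : C⦄ (g : V ⟶ U), R g → F.obj.map g.op x = F.obj.map g.op y) : x = y :=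
  sheaf_sep (underlying F).property hR h

theorem coeff_glue {R : Sieve U} (hR : R ∈ J U)
    (p : ∀ ⦃V : C⦄ (_ : V ⟶ U), F.obj.obj (op V) → Prop)
    (hres : ∀ ⦃V W : C⦄ (g : V ⟶ U) (h : W ⟶ V) (t : F.obj.obj (op V)),
      p g t → p (h ≫ g) (F.obj.map h.op t))
    (huniq : ∀ ⦃V : C⦄ (g : V ⟶ U) (t t' : F.obj.obj (op V)), R g → p g t → p g t' → t = t')
    (hex : ∀ ⦃V : C⦄ (g : V ⟶ U), R g → ∃ t, p g t) :
    ∃ t : F.obj.obj (op U), ∀ ⦃V : C⦄ (g : V ⟶ U), R g → p g (F.obj.map g.op t) :=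
  sheaf_glue (underlying F).property hR p hres huniq hex

end Coefficients

namespace Torsor

variable {F : Sheaf J CommGrpCat.{u + 1}} {X Y : C}

/-! ### The trivial torsor -/

section Trivial
variable [J.Subcanonical]

variable (F X) in
/-- The trivial torsor `F_X = F × X` over `X`. -/
def trivial : Torsor F X where
  sheaf :=
    { obj :=
        { obj := fun U => F.obj.obj U × (U.unop ⟶ X)
          map := fun g => ↾(fun p => (F.obj.map g p.1, g.unop ≫ p.2))
          map_id := fun U => by ext p <;> simp
          map_comp := fun g h => by ext p <;> simp }
      property := by
        refine isSheaf_of_sep_glue (fun U R hR x y h => ?_) (fun U R hR x hx => ?_)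
        · refine Prod.ext (coeff_sep F hR fun V g hg => congrArg Prod.fst (h g hg)) ?_
          exact sheaf_sep (isSheaf_yoneda X) hR fun V g hg => congrArg Prod.snd (h g hg)
        · obtain ⟨f, hf⟩ := sheaf_glue_family (underlying F).property hR
            (fun V g hg => (x g hg).1) (fun V W g h hg => congrArg Prod.fst (hx g h hg))
          obtain ⟨a, ha⟩ := sheaf_glue_family (isSheaf_yoneda X) hR
            (fun V g hg => (x g hg).2) (fun V W g h hg => congrArg Prod.snd (hx g h hg))
          exact ⟨(f, a), fun V g hg => Prod.ext (hf g hg) (ha g hg)⟩ }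
  proj p := p.2
  smul f p := (f * p.1, p.2)
  proj_map _ _ := rfl
  smul_map g f p := Prod.ext (map_mul (F.obj.map g.op).hom f p.1) rfl
  proj_smul _ _ := rfl
  one_smul p := Prod.ext (one_mul _) rfl
  mul_smul f f' p := Prod.ext (mul_assoc _ _ _) rfl
  simply_transitive {U} t t' h :=
    ⟨t'.1 * t.1⁻¹, Prod.ext (inv_mul_cancel_right _ _) h, fun f hf =>
      eq_mul_inv_of_mul_eq (congrArg Prod.fst hf)⟩
  locally_nonempty {U} x := ⟨⊤, J.top_mem U, fun V g _ => ⟨(1, g ≫ x), rfl⟩⟩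

/-- The section `(f, x)` of the trivial torsor. -/
def trivialSec {U : C} (f : F.obj.obj (op U)) (x : U ⟶ X) : (trivial F X).sec U := (f, x)

/-- The trivialisation `F_X ≅ P` of a torsor defined by a section `s : X ⟶ P`, given on
points. -/
def trivialise (P : Torsor F X) (s : ∀ {U : C}, (U ⟶ X) → P.sec U)
    (hpr : ∀ {U : C} (x : U ⟶ X), P.pr (s x) = x)
    (hres : ∀ {U V : C} (g : V ⟶ U) (x : U ⟶ X), P.res g (s x) = s (g ≫ x)) :
    trivial F X ≅ P :=
  haveI := isIso_hom (mkHom (T := trivial F X) (T' := P) (fun {U} p => (p.1 : F.obj.obj (op U)) • s p.2)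
    (fun g p => by rw [res_smul, hres]; rfl)
    (fun p => by rw [pr_smul, hpr]; rfl)
    (fun f p => SemigroupAction.mul_smul f p.1 (s p.2)))
  asIso (mkHom (T := trivial F X) (T' := P) (fun {U} p => (p.1 : F.obj.obj (op U)) • s p.2)
    (fun g p => by rw [res_smul, hres]; rfl)
    (fun p => by rw [pr_smul, hpr]; rfl)
    (fun f p => SemigroupAction.mul_smul f p.1 (s p.2)))

theorem app_trivialise (P : Torsor F X) (s : ∀ {U : C}, (U ⟶ X) → P.sec U) (hpr hres) {U : C}
    (f : F.obj.obj (op U)) (x : U ⟶ X) :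
    app (trivialise P s hpr hres).hom (trivialSec f x) = f • s x := rfl

end Trivial

/-! ### Pull-back -/

section Pullback
variable [J.Subcanonical]

/-- The presheaf `X ×_Y T`. -/
def pullbackPresheaf (f : X ⟶ Y) (T : Torsor F Y) : Cᵒᵖ ⥤ Type (u + 1) where
  obj U := { p : (U.unop ⟶ X) × T.sec U.unop // T.pr p.2 = p.1 ≫ f }
  map g := ↾(fun p => ⟨(g.unop ≫ p.1.1, T.res g.unop p.1.2), by
    rw [pr_res, Category.assoc, p.2]⟩)
  map_id U := by
    refine ConcreteCategory.hom_ext _ _ fun p => ?_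
    exact Subtype.ext (Prod.ext (Category.id_comp p.1.1) (T.res_id p.1.2))
  map_comp g h := by
    refine ConcreteCategory.hom_ext _ _ fun p => ?_
    exact Subtype.ext (Prod.ext (Category.assoc h.unop g.unop p.1.1)
      (T.res_res g.unop h.unop p.1.2).symm)

theorem pullbackPresheaf_isSheaf (f : X ⟶ Y) (T : Torsor F Y) :
    Presheaf.IsSheaf J (pullbackPresheaf f T) := by
  refine isSheaf_of_sep_glue (fun U R hR x y h => ?_) (fun U R hR x hx => ?_)
  · refine Subtype.ext (Prod.ext ?_ ?_)
    · exact sheaf_sep (isSheaf_yoneda X) hR fun V g hg => congrArg (fun p => p.1.1) (h g hg)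
    · exact T.sep hR fun V g hg => congrArg (fun p => p.1.2) (h g hg)
  · obtain ⟨t, ht⟩ := T.glue_family hR
      (fun V g hg => (x g hg).1.2) (fun V W g h hg => congrArg (fun p => p.1.2) (hx g h hg))
    obtain ⟨a, ha⟩ := sheaf_glue_family (isSheaf_yoneda X) hR
      (fun V g hg => (x g hg).1.1) (fun V W g h hg => congrArg (fun p => p.1.1) (hx g h hg))
    refine ⟨⟨(a, t), ?_⟩, fun V g hg => Subtype.ext (Prod.ext (ha g hg) (ht g hg))⟩
    refine sheaf_sep (isSheaf_yoneda Y) hR fun V g hg => ?_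
    change g ≫ T.pr t = g ≫ a ≫ f
    have h1 : g ≫ a = (x g hg).1.1 := ha g hg
    rw [← pr_res, ht g hg, ← Category.assoc]
    exact (x g hg).2.trans (congrArg (fun k => k ≫ f) h1.symm)

/-- The pull-back `f^* T = X ×_Y T` of a torsor over `Y` along `f : X ⟶ Y`. -/
def pullback (f : X ⟶ Y) (T : Torsor F Y) : Torsor F X where
  sheaf := ⟨pullbackPresheaf f T, pullbackPresheaf_isSheaf f T⟩
  proj p := p.1.1
  smul f p := ⟨(p.1.1, f • p.1.2), by rw [pr_smul, p.2]⟩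
  proj_map _ _ := rfl
  smul_map g f p := Subtype.ext (Prod.ext rfl (T.res_smul g f _))
  proj_smul _ _ := rfl
  one_smul p := Subtype.ext (Prod.ext rfl (MulAction.one_smul _))
  mul_smul f f' p := Subtype.ext (Prod.ext rfl (SemigroupAction.mul_smul _ _ _))
  simply_transitive {U} t t' h := by
    have h0 : t.1.1 = t'.1.1 := h
    obtain ⟨f, hf⟩ := T.exists_smul (t := t.1.2) (t' := t'.1.2) (by rw [t.2, t'.2, h0])
    exact ⟨f, Subtype.ext (Prod.ext h0 hf), fun f' hf' =>
      T.smul_inj (t := t.1.2) ((congrArg (fun p => p.1.2) hf').trans hf.symm)⟩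
  locally_nonempty {U} x := by
    obtain ⟨R, hR, h⟩ := T.local_sec (x ≫ f)
    refine ⟨R, hR, fun V g hg => ?_⟩
    obtain ⟨t, ht⟩ := h g hg
    exact ⟨⟨(g ≫ x, t), by rw [ht, Category.assoc]⟩, rfl⟩

/-- The section `(x, t)` of `X ×_Y T`. -/
def pullbackSec (f : X ⟶ Y) (T : Torsor F Y) {U : C} (x : U ⟶ X) (t : T.sec U)
    (h : T.pr t = x ≫ f) : (pullback f T).sec U := ⟨(x, t), h⟩

@[simp] theorem pr_pullbackSec (f : X ⟶ Y) (T : Torsor F Y) {U : C} (x : U ⟶ X) (t : T.sec U)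
    (h : T.pr t = x ≫ f) : (pullback f T).pr (pullbackSec f T x t h) = x := rfl

theorem res_pullbackSec (f : X ⟶ Y) (T : Torsor F Y) {U V : C} (g : V ⟶ U) (x : U ⟶ X)
    (t : T.sec U) (h : T.pr t = x ≫ f) : (pullback f T).res g (pullbackSec f T x t h) =
      pullbackSec f T (g ≫ x) (T.res g t) (by simp [h]) := rfl

theorem smul_pullbackSec (f : X ⟶ Y) (T : Torsor F Y) {U : C} (a : F.obj.obj (op U)) (x : U ⟶ X)
    (t : T.sec U) (h : T.pr t = x ≫ f) : a • pullbackSec f T x t h =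
      pullbackSec f T x (a • t) (by simp [h]) := rfl

/-- Pull-back of morphisms of torsors. -/
def pullbackMap (f : X ⟶ Y) {T T' : Torsor F Y} (φ : T ⟶ T') : pullback f T ⟶ pullback f T' :=
  mkHom (fun p => ⟨(p.1.1, app φ p.1.2), by rw [pr_app, p.2]⟩)
    (fun g p => Subtype.ext (Prod.ext rfl (res_app φ g _)))
    (fun p => rfl)
    (fun a p => Subtype.ext (Prod.ext rfl (app_smul φ a _)))

theorem app_pullbackMap (f : X ⟶ Y) {T T' : Torsor F Y} (φ : T ⟶ T') {U : C} (x : U ⟶ X)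
    (t : T.sec U) (h : T.pr t = x ≫ f) : app (pullbackMap f φ) (pullbackSec f T x t h) =
      pullbackSec f T' x (app φ t) (by simp [h]) := rfl

theorem pullbackMap_id (f : X ⟶ Y) (T : Torsor F Y) : pullbackMap f (𝟙 T) = 𝟙 _ := rfl

theorem pullbackMap_comp (f : X ⟶ Y) {T T' T'' : Torsor F Y} (φ : T ⟶ T') (ψ : T' ⟶ T'') :
    pullbackMap f (φ ≫ ψ) = pullbackMap f φ ≫ pullbackMap f ψ := rfl

end Pullback

/-! ### The dual torsor -/

/-- The dual torsor: the same sheaf over `X` with the inverse action of `F`. -/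
def dual (T : Torsor F X) : Torsor F X where
  sheaf := T.sheaf
  proj := T.proj
  smul f t := T.smul f⁻¹ t
  proj_map := T.proj_map
  smul_map g f t := by
    rw [T.smul_map]
    congr 1
    exact map_inv (F.obj.map g.op).hom f
  proj_smul f t := T.proj_smul _ t
  one_smul t := by rw [inv_one, T.one_smul]
  mul_smul f f' t := by rw [mul_inv, T.mul_smul]
  simply_transitive t t' h := by
    obtain ⟨f, hf, hu⟩ := T.simply_transitive t t' h
    refine ⟨f⁻¹, ?_, fun f' hf' => ?_⟩
    · change T.smul f⁻¹⁻¹ t = t'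
      rw [inv_inv, hf]
    · rw [← hu _ hf', inv_inv]
  locally_nonempty := T.locally_nonempty

/-- The section of the dual torsor given by a section of the torsor. -/
def dualSec (T : Torsor F X) {U : C} (t : T.sec U) : T.dual.sec U := t

@[simp] theorem pr_dualSec (T : Torsor F X) {U : C} (t : T.sec U) :
    T.dual.pr (T.dualSec t) = T.pr t := rfl

theorem res_dualSec (T : Torsor F X) {U V : C} (g : V ⟶ U) (t : T.sec U) :
    T.dual.res g (T.dualSec t) = T.dualSec (T.res g t) := rfl

theorem smul_dualSec (T : Torsor F X) {U : C} (f : F.obj.obj (op U)) (t : T.sec U) :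
    f • T.dualSec t = T.dualSec (f⁻¹ • t) := rfl

/-- The isomorphism of dual torsors induced by an isomorphism `T ⟶ T'`; it is the same morphism
of sheaves. -/
def dualMap {T T' : Torsor F X} (φ : T ⟶ T') : T.dual ⟶ T'.dual :=
  Hom.mk (T := T.dual) (T' := T'.dual) (Hom.hom (T := T) (T' := T') φ)
    (Hom.proj_hom (T := T) (T' := T') φ) (fun f t => Hom.smul_hom (T := T) (T' := T') φ f⁻¹ t)

theorem app_dualMap {T T' : Torsor F X} (φ : T ⟶ T') {U : C} (t : T.sec U) :
    app (dualMap φ) (T.dualSec t) = T'.dualSec (app φ t) := rfl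

theorem dualMap_id (T : Torsor F X) : dualMap (𝟙 T) = 𝟙 _ := rfl

theorem dualMap_comp {T T' T'' : Torsor F X} (φ : T ⟶ T') (ψ : T' ⟶ T'') :
    dualMap (φ ≫ ψ) = dualMap φ ≫ dualMap ψ := rfl

end Torsor

namespace Torsor

variable {F : Sheaf J CommGrpCat.{u + 1}} {X Y : C}

/-! ### The contracted product -/

section Tensor

variable (T T' : Torsor F X)

/-- Sections over `U` of the fibre product `T ×_X T'`. -/
abbrev Pair (U : C) : Type (u + 1) := { p : T.sec U × T'.sec U // T.pr p.1 = T'.pr p.2 }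

/-- The equivalence relation `(t, t') ∼ (f t, f⁻¹ t')` on `T ×_X T'`. -/
def pairSetoid (U : C) : Setoid (Pair T T' U) where
  r p q := ∃ f : F.obj.obj (op U), f • p.1.1 = q.1.1 ∧ f⁻¹ • p.1.2 = q.1.2
  iseqv :=
    { refl := fun p => ⟨1, MulAction.one_smul _, by rw [inv_one]; exact MulAction.one_smul _⟩
      symm := by
        rintro p q ⟨f, h1, h2⟩
        exact ⟨f⁻¹, by rw [← h1, inv_smul_smul], by rw [← h2, inv_inv, smul_inv_smul]⟩
      trans := by
        rintro p q r ⟨f, h1, h2⟩ ⟨g, h3, h4⟩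
        refine ⟨g * f, ?_, ?_⟩
        · rw [← h3, ← h1, SemigroupAction.mul_smul]
        · rw [← h4, ← h2, mul_inv, SemigroupAction.mul_smul] }

/-- Restriction of pairs. -/
def Pair.res {T T' : Torsor F X} {U V : C} (g : V ⟶ U) (p : Pair T T' U) : Pair T T' V :=
  ⟨(T.res g p.1.1, T'.res g p.1.2), by rw [pr_res, pr_res, p.2]⟩

theorem Pair.res_rel {T T' : Torsor F X} {U V : C} (g : V ⟶ U) {p q : Pair T T' U}
    (h : (pairSetoid T T' U).r p q) : (pairSetoid T T' V).r (p.res g) (q.res g) := by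
  obtain ⟨f, h1, h2⟩ := h
  refine ⟨F.obj.map g.op f, ?_, ?_⟩
  · exact (T.res_smul g f _).symm.trans (congrArg _ h1)
  · have h3 : (F.obj.map g.op f)⁻¹ = F.obj.map g.op f⁻¹ := (map_inv (F.obj.map g.op).hom f).symm
    rw [h3]
    exact (T'.res_smul g f⁻¹ _).symm.trans (congrArg _ h2)

/-- The presheaf quotient of `T ×_X T'` by the action `f (t, t') = (f t, f⁻¹ t')` of `F`. -/
def preTensor : Cᵒᵖ ⥤ Type (u + 1) where
  obj U := Quotient (pairSetoid T T' U.unop)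
  map {U V} g := ↾(Quotient.map' (s₁ := pairSetoid T T' U.unop) (s₂ := pairSetoid T T' V.unop)
    (Pair.res g.unop) (fun _ _ h => Pair.res_rel g.unop h))
  map_id U := by
    refine ConcreteCategory.hom_ext _ _ fun q => ?_
    induction q using Quotient.inductionOn with
    | _ p =>
      exact congrArg (Quotient.mk _) (Subtype.ext (Prod.ext (T.res_id p.1.1) (T'.res_id p.1.2)))
  map_comp g h := by
    refine ConcreteCategory.hom_ext _ _ fun q => ?_
    induction q using Quotient.inductionOn with
    | _ p =>
      exact congrArg (Quotient.mk _) (Subtype.ext (Prod.ext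
        (T.res_res g.unop h.unop p.1.1).symm (T'.res_res g.unop h.unop p.1.2).symm))

/-- The sheaf underlying the contracted product: the sheafification of the quotient. -/
def tensorSheaf : Sheaf J (Type (u + 1)) := (presheafToSheaf J (Type (u + 1))).obj (preTensor T T')

/-- Sections of the contracted product. -/
def tsec (U : C) : Type (u + 1) := (tensorSheaf T T').obj.obj (op U)

/-- Restriction of sections of the contracted product. -/
def tres {U V : C} (g : V ⟶ U) (x : tsec T T' U) : tsec T T' V := (tensorSheaf T T').obj.map g.op x

variable {T T'}

/-- The section `t ⊗ t'` of the contracted product, for `t`, `t'` over the same point of `X`. -/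
def tmk {U : C} (t : T.sec U) (t' : T'.sec U) (h : T.pr t = T'.pr t') : tsec T T' U :=
  (toSheafify J (preTensor T T')).app (op U) (Quotient.mk (pairSetoid T T' U) ⟨(t, t'), h⟩)

section Basic
variable {U V W : C}

theorem tres_id (x : tsec T T' U) : tres T T' (𝟙 U) x = x :=
  presheaf_map_id (tensorSheaf T T').obj x

theorem tres_tres (g : V ⟶ U) (h : W ⟶ V) (x : tsec T T' U) :
    tres T T' h (tres T T' g x) = tres T T' (h ≫ g) x :=
  presheaf_map_map (tensorSheaf T T').obj g h x

theorem tres_tmk (g : V ⟶ U) (t : T.sec U) (t' : T'.sec U) (h : T.pr t = T'.pr t') :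
    tres T T' g (tmk t t' h) = tmk (T.res g t) (T'.res g t') (by simp [h]) :=
  (NatTrans.naturality_apply (toSheafify J (preTensor T T')) g.op _).symm

theorem tmk_rel (f : F.obj.obj (op U)) (t : T.sec U) (t' : T'.sec U) (h : T.pr t = T'.pr t') :
    tmk (f • t) t' (by simp [h]) = tmk t (f • t') (by simp [h]) := by
  refine congrArg ((toSheafify J (preTensor T T')).app (op U)) (Quotient.sound ?_)
  exact ⟨f⁻¹, inv_smul_smul _ _, by rw [inv_inv]⟩

theorem tsep {R : Sieve U} (hR : R ∈ J U) {x y : tsec T T' U}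
    (h : ∀ ⦃V : C⦄ (g : V ⟶ U), R g → tres T T' g x = tres T T' g y) : x = y :=
  sheaf_sep (tensorSheaf T T').property hR h

theorem tglue {R : Sieve U} (hR : R ∈ J U) (p : ∀ ⦃V : C⦄ (_ : V ⟶ U), tsec T T' V → Prop)
    (hres : ∀ ⦃V W : C⦄ (g : V ⟶ U) (h : W ⟶ V) (t : tsec T T' V),
      p g t → p (h ≫ g) (tres T T' h t))
    (huniq : ∀ ⦃V : C⦄ (g : V ⟶ U) (t t' : tsec T T' V), R g → p g t → p g t' → t = t')
    (hex : ∀ ⦃V : C⦄ (g : V ⟶ U), R g → ∃ t, p g t) :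
    ∃ t : tsec T T' U, ∀ ⦃V : C⦄ (g : V ⟶ U), R g → p g (tres T T' g t) :=
  sheaf_glue (tensorSheaf T T').property hR p hres huniq hex

theorem tlocal (x : tsec T T' U) : ∃ R ∈ J U, ∀ ⦃V : C⦄ (g : V ⟶ U), R g →
    ∃ (t : T.sec V) (t' : T'.sec V) (h : T.pr t = T'.pr t'), tres T T' g x = tmk t t' h := by
  refine ⟨_, Presheaf.imageSieve_mem J (toSheafify J (preTensor T T')) (U := op U) x, ?_⟩
  rintro V g ⟨q, hq⟩
  induction q using Quotient.inductionOn with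
  | _ p => exact ⟨p.1.1, p.1.2, p.2, hq.symm⟩

theorem tmk_eq_local {t s : T.sec U} {t' s' : T'.sec U} {h : T.pr t = T'.pr t'}
    {k : T.pr s = T'.pr s'} (e : tmk t t' h = tmk s s' k) :
    ∃ R ∈ J U, ∀ ⦃V : C⦄ (g : V ⟶ U), R g → ∃ f : F.obj.obj (op V),
      f • T.res g t = T.res g s ∧ f⁻¹ • T'.res g t' = T'.res g s' := by
  refine ⟨_, Presheaf.equalizerSieve_mem J (toSheafify J (preTensor T T')) (X := op U) _ _ e, ?_⟩
  intro V g hg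
  exact Quotient.exact (s := pairSetoid T T' V) hg

theorem tmk_eq {t s : T.sec U} {t' s' : T'.sec U} {h : T.pr t = T'.pr t'}
    {k : T.pr s = T'.pr s'} (e : tmk t t' h = tmk s s' k) :
    ∃ f : F.obj.obj (op U), f • t = s ∧ f⁻¹ • t' = s' := by
  obtain ⟨R, hR, H⟩ := tmk_eq_local e
  obtain ⟨f, hf⟩ := coeff_glue F hR
    (fun V g f => f • T.res g t = T.res g s ∧ f⁻¹ • T'.res g t' = T'.res g s')
    (fun V W g h f hf => by
      have h3 : (F.obj.map h.op f)⁻¹ = F.obj.map h.op f⁻¹ := (map_inv (F.obj.map h.op).hom f).symm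
      rw [h3]
      constructor
      · rw [← res_res, ← res_smul, hf.1, res_res]
      · rw [← res_res, ← res_smul, hf.2, res_res])
    (fun V g f f' _ hf hf' => T.smul_inj (hf.1.trans hf'.1.symm)) H
  refine ⟨f, T.sep hR fun V g hg => ?_, T'.sep hR fun V g hg => ?_⟩
  · rw [res_smul, (hf g hg).1]
  · have h3 : F.obj.map g.op f⁻¹ = (F.obj.map g.op f)⁻¹ := map_inv (F.obj.map g.op).hom f
    rw [res_smul, h3, (hf g hg).2]

/-- The element `y` is `f x`, if this holds for all local representatives `t ⊗ t'` of `x`. -/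
def IsSmul (f : F.obj.obj (op U)) (x y : tsec T T' U) : Prop :=
  ∀ ⦃V : C⦄ (g : V ⟶ U) (t : T.sec V) (t' : T'.sec V) (h : T.pr t = T'.pr t'),
    tres T T' g x = tmk t t' h →
      tres T T' g y = tmk ((F.obj.map g.op f : F.obj.obj (op V)) • t) t' (by simp [h])

theorem isSmul_tmk (f : F.obj.obj (op U)) (t : T.sec U) (t' : T'.sec U) (h : T.pr t = T'.pr t') :
    IsSmul f (tmk t t' h) (tmk (f • t) t' (by simp [h])) := by
  intro V g s s' k e
  rw [tres_tmk] at e ⊢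
  obtain ⟨a, rfl, ha⟩ := tmk_eq e
  have ha' : T'.res g t' = a • s' := by rw [← ha, smul_inv_smul]
  simp only [ha', res_smul, smul_smul, mul_comm _ a]
  rw [← tmk_rel]
  · simp only [smul_smul]
  · rw [pr_smul, ← k, pr_smul]

theorem existsUnique_isSmul (f : F.obj.obj (op U)) (x : tsec T T' U) : ∃! y, IsSmul f x y := by
  obtain ⟨R, hR, H⟩ := tlocal x
  obtain ⟨y, hy⟩ := tglue hR
    (fun V g y => IsSmul (F.obj.map g.op f : F.obj.obj (op V)) (tres T T' g x) y)
    (fun V W g h y hy V' g' t t' k e => by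
      rw [tres_tres] at e ⊢
      rw [← tres_tres, tres_tres] at e
      rw [hy (g' ≫ h) t t' k (by rw [← e, tres_tres, Category.assoc])]
      simp only [coeff_map_map, Category.assoc])
    (fun V g y y' hg hy hy' => by
      obtain ⟨t, t', h, e⟩ := H g hg
      rw [← tres_id y, ← tres_id y', hy (𝟙 V) t t' h (by rw [tres_id, e]),
        hy' (𝟙 V) t t' h (by rw [tres_id, e])])
    (fun V g hg => by
      obtain ⟨t, t', h, e⟩ := H g hg
      exact ⟨_, e ▸ isSmul_tmk _ t t' h⟩)
  refine ⟨y, fun V g t t' h e => ?_, fun y' hy' => tsep hR fun V g hg => ?_⟩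
  · refine tsep (J.pullback_stable g hR) fun W k hk => ?_
    have := hy (k ≫ g) hk (𝟙 W) (T.res k t) (T'.res k t') (by simp [h])
      (by rw [tres_id, ← tres_tres, e, tres_tmk])
    rw [tres_id] at this
    rw [tres_tres, this, tres_tmk]
    simp only [res_smul, coeff_map_map, Category.id_comp]
  · obtain ⟨t, t', h, e⟩ := H g hg
    have := hy g hg (𝟙 V) t t' h (by rw [tres_id, e])
    rw [tres_id] at this
    rw [hy' g t t' h e, this]
    simp only [coeff_map_id]

/-- The action of `F` on the contracted product; on pure tensors, `f (t ⊗ t') = f t ⊗ t'`. -/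
def tsmul (f : F.obj.obj (op U)) (x : tsec T T' U) : tsec T T' U :=
  (existsUnique_isSmul f x).choose

theorem tsmul_spec (f : F.obj.obj (op U)) (x : tsec T T' U) : IsSmul f x (tsmul f x) :=
  (existsUnique_isSmul f x).choose_spec.1

theorem tsmul_unique {f : F.obj.obj (op U)} {x y : tsec T T' U} (h : IsSmul f x y) :
    tsmul f x = y := (existsUnique_isSmul f x).unique (tsmul_spec f x) h

theorem tsmul_tmk (f : F.obj.obj (op U)) (t : T.sec U) (t' : T'.sec U) (h : T.pr t = T'.pr t') :
    tsmul f (tmk t t' h) = tmk (f • t) t' (by simp [h]) := tsmul_unique (isSmul_tmk f t t' h)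

theorem tres_tsmul (g : V ⟶ U) (f : F.obj.obj (op U)) (x : tsec T T' U) :
    tres T T' g (tsmul f x) = tsmul (F.obj.map g.op f) (tres T T' g x) := by
  refine (tsmul_unique fun W k t t' h e => ?_).symm
  rw [tres_tres] at e ⊢
  rw [tsmul_spec f x (k ≫ g) t t' h e]
  simp only [coeff_map_map]

/-- The point of `X` under a section of the contracted product, if `t ⊗ t'` lies over the same
point as `t` and `t'`. -/
def IsProj (x : tsec T T' U) (a : U ⟶ X) : Prop :=
  ∀ ⦃V : C⦄ (g : V ⟶ U) (t : T.sec V) (t' : T'.sec V) (h : T.pr t = T'.pr t'),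
    tres T T' g x = tmk t t' h → g ≫ a = T.pr t

theorem isProj_tmk (t : T.sec U) (t' : T'.sec U) (h : T.pr t = T'.pr t') :
    IsProj (tmk t t' h) (T.pr t) := by
  intro V g s s' k e
  rw [tres_tmk] at e
  obtain ⟨a, rfl, -⟩ := tmk_eq e
  simp

variable [J.Subcanonical]

theorem existsUnique_isProj (x : tsec T T' U) : ∃! a, IsProj x a := by
  obtain ⟨R, hR, H⟩ := tlocal x
  obtain ⟨a, ha⟩ := sheaf_glue (isSheaf_yoneda X) hR
    (fun V g a => IsProj (tres T T' g x) a)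
    (fun V W g h a ha V' g' t t' k e => by
      refine Eq.trans ?_ (ha (g' ≫ h) t t' k (by rw [← e, tres_tres, tres_tres, Category.assoc]))
      exact (Category.assoc _ _ _).symm)
    (fun V g a a' hg ha ha' => by
      obtain ⟨t, t', h, e⟩ := H g hg
      have h1 := ha (𝟙 V) t t' h (by rw [tres_id, e])
      have h2 := ha' (𝟙 V) t t' h (by rw [tres_id, e])
      exact (Category.id_comp _).symm.trans (h1.trans (h2.symm.trans (Category.id_comp _))))
    (fun V g hg => by
      obtain ⟨t, t', h, e⟩ := H g hg
      exact ⟨T.pr t, e ▸ isProj_tmk t t' h⟩)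
  refine ⟨a, fun V g t t' h e => ?_, fun a' ha' => ?_⟩
  · refine sheaf_sep (isSheaf_yoneda X) (J.pullback_stable g hR) fun W k hk => ?_
    have := ha (k ≫ g) hk (𝟙 W) (T.res k t) (T'.res k t') (by simp [h])
      (by rw [tres_id, ← tres_tres, e, tres_tmk])
    change k ≫ g ≫ a = k ≫ T.pr t
    rw [← pr_res, ← this]
    exact (Category.assoc _ _ _).symm.trans (Category.id_comp _).symm
  · refine sheaf_sep (isSheaf_yoneda X) hR fun V g hg => ?_
    obtain ⟨t, t', h, e⟩ := H g hg
    have := ha g hg (𝟙 V) t t' h (by rw [tres_id, e])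
    exact (ha' g t t' h e).trans (this.symm.trans (Category.id_comp _))

/-- The structure morphism to `X` of the contracted product. -/
def tpr (x : tsec T T' U) : U ⟶ X := (existsUnique_isProj x).choose

theorem tpr_spec (x : tsec T T' U) : IsProj x (tpr x) := (existsUnique_isProj x).choose_spec.1

theorem tpr_unique {x : tsec T T' U} {a : U ⟶ X} (h : IsProj x a) : tpr x = a :=
  (existsUnique_isProj x).unique (tpr_spec x) h

theorem tpr_tmk (t : T.sec U) (t' : T'.sec U) (h : T.pr t = T'.pr t') :
    tpr (tmk t t' h) = T.pr t := tpr_unique (isProj_tmk t t' h)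

theorem tpr_tres (g : V ⟶ U) (x : tsec T T' U) : tpr (tres T T' g x) = g ≫ tpr x := by
  refine tpr_unique fun W k t t' h e => ?_
  rw [tres_tres] at e
  rw [← tpr_spec x (k ≫ g) t t' h e, Category.assoc]

theorem hom_sep {R : Sieve U} (hR : R ∈ J U) {x y : U ⟶ X}
    (h : ∀ ⦃V : C⦄ (g : V ⟶ U), R g → g ≫ x = g ≫ y) : x = y :=
  sheaf_sep (isSheaf_yoneda X) hR h

end Basic

variable [J.Subcanonical]

theorem tpr_tsmul {U : C} (f : F.obj.obj (op U)) (x : tsec T T' U) : tpr (tsmul f x) = tpr x := by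
  obtain ⟨R, hR, H⟩ := tlocal x
  refine hom_sep hR fun V g hg => ?_
  obtain ⟨t, t', h, e⟩ := H g hg
  rw [← tpr_tres, ← tpr_tres, tres_tsmul, e, tsmul_tmk, tpr_tmk, tpr_tmk, pr_smul]

variable (T T')

/-- The contracted product `T ⊗ T'` of two `F`-torsors over `X`: the quotient sheaf of `T ×_X T'`
by the action `f (t, t') = (f t, f⁻¹ t')` of `F`, with `F` acting on either factor. -/
def tensor : Torsor F X where
  sheaf := tensorSheaf T T'
  proj x := tpr (T := T) (T' := T') x
  smul f x := tsmul (T := T) (T' := T') f x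
  proj_map g x := tpr_tres g x
  smul_map g f x := tres_tsmul g f x
  proj_smul f x := tpr_tsmul f x
  one_smul {U} x := by
    change tsec T T' U at x
    obtain ⟨R, hR, H⟩ := tlocal x
    refine tsep (T := T) (T' := T') hR fun V g hg => ?_
    obtain ⟨t, t', h, e⟩ := H g hg
    rw [tres_tsmul, e, tsmul_tmk]
    simp only [map_one, MulAction.one_smul]
  mul_smul {U} f f' x := by
    change tsec T T' U at x
    obtain ⟨R, hR, H⟩ := tlocal x
    refine tsep (T := T) (T' := T') hR fun V g hg => ?_
    obtain ⟨t, t', h, e⟩ := H g hg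
    rw [tres_tsmul, tres_tsmul, tres_tsmul, e, tsmul_tmk, tsmul_tmk, tsmul_tmk]
    simp only [map_mul, SemigroupAction.mul_smul]
  simply_transitive {U} x y hxy := by
    change tsec T T' U at x
    change tsec T T' U at y
    change tpr x = tpr y at hxy
    obtain ⟨R, hR, H⟩ := tlocal x
    obtain ⟨R', hR', H'⟩ := tlocal y
    have inj : ∀ {V : C} (g : V ⟶ U) (f f' : F.obj.obj (op V)), R g →
        tsmul f (tres T T' g x) = tsmul f' (tres T T' g x) → f = f' := by
      intro V g f f' hg e
      obtain ⟨t, t', h, e'⟩ := H g hg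
      rw [e', tsmul_tmk, tsmul_tmk] at e
      obtain ⟨a, h1, h2⟩ := tmk_eq e
      have h3 : a⁻¹ = 1 := T'.smul_inj (h2.trans (MulAction.one_smul _).symm)
      rw [inv_eq_one] at h3
      rw [h3, MulAction.one_smul] at h1
      exact T.smul_inj h1
    have hRR := J.intersection_covering hR hR'
    obtain ⟨f, hf⟩ := coeff_glue F hRR
      (fun V g f => tsmul f (tres T T' g x) = tres T T' g y)
      (fun V W g h f hf => by rw [← tres_tres, ← tres_tsmul, hf, tres_tres])
      (fun V g f f' hg hf hf' => inj g f f' hg.1 (hf.trans hf'.symm))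
      (fun V g hg => by
        obtain ⟨t, t', h, e⟩ := H g hg.1
        obtain ⟨s, s', k, e'⟩ := H' g hg.2
        have hts : T.pr t = T.pr s := by
          rw [← tpr_tmk t t' h, ← tpr_tmk s s' k, ← e, ← e', tpr_tres, tpr_tres, hxy]
        obtain ⟨a, ha⟩ := T.exists_smul hts
        obtain ⟨b, hb⟩ := T'.exists_smul (t := t') (t' := s') (by rw [← h, ← k, hts])
        refine ⟨b * a, ?_⟩
        rw [e, e', tsmul_tmk]
        simp only [SemigroupAction.mul_smul, ha]
        rw [tmk_rel _ _ _ (by rw [← hts, h])]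
        simp only [hb])
    refine ⟨f, tsep (T := T) (T' := T') hRR fun V g hg => ?_, fun f' hf' => ?_⟩
    · rw [tres_tsmul, hf g hg]
    · refine coeff_sep F hRR fun V g hg => inj g _ _ hg.1 ?_
      rw [← tres_tsmul, ← tres_tsmul]
      refine (congrArg (tres T T' g) hf').trans ?_
      rw [tres_tsmul, hf g hg]
  locally_nonempty {U} x := by
    obtain ⟨R, hR, H⟩ := T.local_sec x
    obtain ⟨R', hR', H'⟩ := T'.local_sec x
    refine ⟨_, J.intersection_covering hR hR', fun V g hg => ?_⟩
    obtain ⟨t, ht⟩ := H g hg.1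
    obtain ⟨t', ht'⟩ := H' g hg.2
    exact ⟨tmk t t' (ht.trans ht'.symm), (tpr_tmk _ _ _).trans ht⟩

variable {T T'}

/-- The section `t ⊗ t'` of the contracted product, for `t`, `t'` over the same point of `X`. -/
def tmul {U : C} (t : T.sec U) (t' : T'.sec U) (h : T.pr t = T'.pr t') : (tensor T T').sec U :=
  tmk t t' h

section
variable {U V : C}

@[simp] theorem pr_tmul (t : T.sec U) (t' : T'.sec U) (h : T.pr t = T'.pr t') :
    (tensor T T').pr (tmul t t' h) = T.pr t := tpr_tmk t t' h

theorem tmul_congr {t s : T.sec U} {t' s' : T'.sec U} (h : T.pr t = T'.pr t') (e : t = s)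
    (e' : t' = s') : tmul t t' h = tmul s s' (by rw [← e, ← e', h]) := by
  subst e e'
  rfl

theorem res_tmul (g : V ⟶ U) (t : T.sec U) (t' : T'.sec U) (h : T.pr t = T'.pr t') :
    (tensor T T').res g (tmul t t' h) = tmul (T.res g t) (T'.res g t') (by simp [h]) :=
  tres_tmk g t t' h

theorem smul_tmul_left (f : F.obj.obj (op U)) (t : T.sec U) (t' : T'.sec U)
    (h : T.pr t = T'.pr t') : tmul (f • t) t' (by simp [h]) = f • tmul t t' h :=
  (tsmul_tmk f t t' h).symm

theorem smul_tmul_right (f : F.obj.obj (op U)) (t : T.sec U) (t' : T'.sec U)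
    (h : T.pr t = T'.pr t') : tmul t (f • t') (by simp [h]) = f • tmul t t' h :=
  (tmk_rel f t t' h).symm.trans (smul_tmul_left f t t' h)

theorem smul_tmul_smul (f f' : F.obj.obj (op U)) (t : T.sec U) (t' : T'.sec U)
    (h : T.pr t = T'.pr t') : tmul (f • t) (f' • t') (by simp [h]) = (f * f') • tmul t t' h := by
  rw [smul_tmul_left f t (f' • t') (by simp [h]), smul_tmul_right f' t t' h,
    SemigroupAction.mul_smul]

theorem tmul_local (x : (tensor T T').sec U) : ∃ R ∈ J U, ∀ ⦃V : C⦄ (g : V ⟶ U), R g →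
    ∃ (t : T.sec V) (t' : T'.sec V) (h : T.pr t = T'.pr t'),
      (tensor T T').res g x = tmul t t' h := tlocal x

end

variable {S S' : Torsor F X}

/-- The map of presheaf quotients induced by morphisms of torsors. -/
def preTensorMap (φ : T ⟶ S) (ψ : T' ⟶ S') : preTensor T T' ⟶ preTensor S S' where
  app U := ↾(Quotient.map' (s₁ := pairSetoid T T' U.unop) (s₂ := pairSetoid S S' U.unop)
    (fun p => ⟨(app φ p.1.1, app ψ p.1.2), by rw [pr_app, pr_app, p.2]⟩)
    (fun p q ⟨f, h1, h2⟩ => ⟨f, (app_smul φ f _).symm.trans (congrArg _ h1),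
      (app_smul ψ f⁻¹ _).symm.trans (congrArg _ h2)⟩))
  naturality U V g := by
    refine ConcreteCategory.hom_ext _ _ fun q => ?_
    induction q using Quotient.inductionOn with
    | _ p =>
      exact congrArg (Quotient.mk _) (Subtype.ext (Prod.ext
        (res_app φ g.unop p.1.1).symm (res_app ψ g.unop p.1.2).symm))

/-- The induced morphism of sheaves on sections. -/
def tmap (φ : T ⟶ S) (ψ : T' ⟶ S') {U : C} (x : (tensor T T').sec U) : (tensor S S').sec U :=
  ((presheafToSheaf J (Type (u + 1))).map (preTensorMap φ ψ)).hom.app (op U) x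

theorem tmap_tmul (φ : T ⟶ S) (ψ : T' ⟶ S') {U : C} (t : T.sec U) (t' : T'.sec U)
    (h : T.pr t = T'.pr t') :
    tmap φ ψ (tmul t t' h) = tmul (app φ t) (app ψ t') (by simp [h]) := by
  have := congrArg (fun k => k.app (op U)) (toSheafify_naturality J (preTensorMap φ ψ))
  exact (ConcreteCategory.congr_hom this (Quotient.mk (pairSetoid T T' U) ⟨(t, t'), h⟩)).symm

theorem res_tmap (φ : T ⟶ S) (ψ : T' ⟶ S') {U V : C} (g : V ⟶ U) (x : (tensor T T').sec U) :
    (tensor S S').res g (tmap φ ψ x) = tmap φ ψ ((tensor T T').res g x) :=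
  (NatTrans.naturality_apply ((presheafToSheaf J (Type (u + 1))).map (preTensorMap φ ψ)).hom
    g.op x).symm

/-- Functoriality of the contracted product. -/
def tensorMap (φ : T ⟶ S) (ψ : T' ⟶ S') : tensor T T' ⟶ tensor S S' :=
  mkHom (fun x => tmap φ ψ x) (fun g x => res_tmap φ ψ g x)
    (fun {U} x => by
      obtain ⟨R, hR, H⟩ := tmul_local x
      refine hom_sep hR fun V g hg => ?_
      obtain ⟨t, t', h, e⟩ := H g hg
      rw [← pr_res, ← pr_res, res_tmap, e, tmap_tmul, pr_tmul, pr_tmul, pr_app])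
    (fun {U} f x => by
      obtain ⟨R, hR, H⟩ := tmul_local x
      refine sep _ hR fun V g hg => ?_
      obtain ⟨t, t', h, e⟩ := H g hg
      rw [res_tmap, res_smul, res_smul, res_tmap, e, tmap_tmul, ← smul_tmul_left, tmap_tmul,
        ← smul_tmul_left]
      simp only [app_smul])

theorem app_tensorMap (φ : T ⟶ S) (ψ : T' ⟶ S') {U : C} (t : T.sec U) (t' : T'.sec U)
    (h : T.pr t = T'.pr t') :
    app (tensorMap φ ψ) (tmul t t' h) = tmul (app φ t) (app ψ t') (by simp [h]) :=
  tmap_tmul φ ψ t t' h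

/-- Morphisms out of a contracted product are determined by pure tensors. -/
theorem tensor_hom_ext {P : Torsor F X} {φ ψ : tensor T T' ⟶ P}
    (H : ∀ (U : C) (t : T.sec U) (t' : T'.sec U) (h : T.pr t = T'.pr t'),
      app φ (tmul t t' h) = app ψ (tmul t t' h)) : φ = ψ := by
  refine hom_ext fun U x => ?_
  obtain ⟨R, hR, K⟩ := tmul_local x
  refine sep _ hR fun V g hg => ?_
  obtain ⟨t, t', h, e⟩ := K g hg
  rw [res_app, res_app, e, H]

theorem tensorMap_id (T T' : Torsor F X) : tensorMap (𝟙 T) (𝟙 T') = 𝟙 (tensor T T') :=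
  tensor_hom_ext fun _ t t' h => app_tensorMap _ _ t t' h

theorem tensorMap_comp {P P' : Torsor F X} (φ : T ⟶ S) (ψ : T' ⟶ S') (φ' : S ⟶ P) (ψ' : S' ⟶ P') :
    tensorMap (φ ≫ φ') (ψ ≫ ψ') = tensorMap φ ψ ≫ tensorMap φ' ψ' :=
  tensor_hom_ext fun _ t t' h => by
    rw [app_comp, app_tensorMap, app_tensorMap, app_tensorMap]
    rfl

end Tensor

end Torsor

/-! ### Extension data -/

section Simplicial

variable [CartesianMonoidalCategory C] (G : C)

/-- The morphism `p_{0,1} = id × p₀ : G³ ⟶ G²`. -/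
def p01 : G ⊗ G ⊗ G ⟶ G ⊗ G := G ◁ fst G G

/-- The morphism `p_{1,2} = p₁ × id : G³ ⟶ G²`. -/
def p12 : G ⊗ G ⊗ G ⟶ G ⊗ G := (α_ G G G).inv ≫ snd G G ▷ G

theorem p12_fst : p12 G ≫ fst G G = p01 G ≫ snd G G := by simp [p12, p01]

variable [GrpObj G]

/-- The morphism `m_{0,1} = m × id : G³ ⟶ G²`. -/
def m01 : G ⊗ G ⊗ G ⟶ G ⊗ G := (α_ G G G).inv ≫ μ[G] ▷ G

/-- The morphism `m_{1,2} = id × m : G³ ⟶ G²`. -/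
def m12 : G ⊗ G ⊗ G ⟶ G ⊗ G := G ◁ μ[G]

theorem m01_fst : m01 G ≫ fst G G = p01 G ≫ μ[G] := by
  simp only [m01, p01, Category.assoc, whiskerRight_fst]
  rw [← Category.assoc]
  congr 1
  ext <;> simp

theorem m01_snd : m01 G ≫ snd G G = p12 G ≫ snd G G := by simp [m01, p12]

theorem m12_fst : m12 G ≫ fst G G = p01 G ≫ fst G G := by simp [m12, p01]

theorem m12_snd : m12 G ≫ snd G G = p12 G ≫ μ[G] := by
  simp only [m12, p12, whiskerLeft_snd]
  congr 1
  ext <;> simp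

theorem m12_mul : m12 G ≫ μ[G] = m01 G ≫ μ[G] := by
  simp [m12, m01]

end Simplicial

open ExtData.Torsor

section Delta

variable [CartesianMonoidalCategory C] [J.Subcanonical]
variable (F : Sheaf J CommGrpCat.{u + 1}) (G : C) [GrpObj G]

/-- The functor `δ¹ T = p₁^* T ⊗ (m^* T)^∨ ⊗ p₀^* T` from `F`-torsors over `G` to `F`-torsors
over `G²`. -/
def delta1 : Torsor F G ⥤ Torsor F (G ⊗ G) where
  obj T := tensor (tensor (pullback (snd G G) T) (dual (pullback μ[G] T))) (pullback (fst G G) T)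
  map φ := tensorMap (tensorMap (pullbackMap (snd G G) φ) (dualMap (pullbackMap μ[G] φ)))
    (pullbackMap (fst G G) φ)
  map_id T := by
    simp only [pullbackMap_id, dualMap_id, tensorMap_id]
  map_comp φ ψ := by
    simp only [pullbackMap_comp, dualMap_comp, tensorMap_comp]

/-- The functor `δ² P = p_{1,2}^* P ⊗ (m_{0,1}^* P)^∨ ⊗ m_{1,2}^* P ⊗ (p_{0,1}^* P)^∨` from
`F`-torsors over `G²` to `F`-torsors over `G³`. -/
def delta2 : Torsor F (G ⊗ G) ⥤ Torsor F (G ⊗ G ⊗ G) where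
  obj P := tensor (tensor (tensor (pullback (p12 G) P) (dual (pullback (m01 G) P)))
    (pullback (m12 G) P)) (dual (pullback (p01 G) P))
  map φ := tensorMap (tensorMap (tensorMap (pullbackMap (p12 G) φ)
    (dualMap (pullbackMap (m01 G) φ))) (pullbackMap (m12 G) φ)) (dualMap (pullbackMap (p01 G) φ))
  map_id P := by
    simp only [pullbackMap_id, dualMap_id, tensorMap_id]
  map_comp φ ψ := by
    simp only [pullbackMap_comp, dualMap_comp, tensorMap_comp]

variable {F G} {U V : C}

/-- The section `b ⊗ c^∨ ⊗ a` of `δ¹ T` over a point `x` of `G²`, where `a`, `b`, `c` are sections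
of `T` over `p₀ x`, `p₁ x` and `m x`. -/
def delta1Sec (T : Torsor F G) (x : U ⟶ G ⊗ G) (b c a : T.sec U) (hb : T.pr b = x ≫ snd G G)
    (hc : T.pr c = x ≫ μ[G]) (ha : T.pr a = x ≫ fst G G) : ((delta1 F G).obj T).sec U :=
  tmul (tmul (pullbackSec (snd G G) T x b hb) (dualSec _ (pullbackSec μ[G] T x c hc))
    (by rw [pr_dualSec, pr_pullbackSec, pr_pullbackSec]))
    (pullbackSec (fst G G) T x a ha) (by rw [pr_tmul, pr_pullbackSec, pr_pullbackSec])

/-- The section `s₁ ⊗ s₂^∨ ⊗ s₃ ⊗ s₄^∨` of `δ² P` over a point `x` of `G³`, where `s₁`, `s₂`,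
`s₃`, `s₄` are sections of `P` over the points `p_{1,2} x`, `m_{0,1} x`, `m_{1,2} x`,
`p_{0,1} x`. -/
def delta2Sec (P : Torsor F (G ⊗ G)) (x : U ⟶ G ⊗ G ⊗ G) (s₁ s₂ s₃ s₄ : P.sec U)
    (h₁ : P.pr s₁ = x ≫ p12 G) (h₂ : P.pr s₂ = x ≫ m01 G) (h₃ : P.pr s₃ = x ≫ m12 G)
    (h₄ : P.pr s₄ = x ≫ p01 G) : ((delta2 F G).obj P).sec U :=
  tmul (tmul (tmul (pullbackSec (p12 G) P x s₁ h₁) (dualSec _ (pullbackSec (m01 G) P x s₂ h₂))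
        (by rw [pr_dualSec, pr_pullbackSec, pr_pullbackSec]))
      (pullbackSec (m12 G) P x s₃ h₃) (by rw [pr_tmul, pr_pullbackSec, pr_pullbackSec]))
    (dualSec _ (pullbackSec (p01 G) P x s₄ h₄))
    (by rw [pr_tmul, pr_tmul, pr_dualSec, pr_pullbackSec, pr_pullbackSec])

section
variable (T : Torsor F G) (x : U ⟶ G ⊗ G) (b c a : T.sec U) (hb : T.pr b = x ≫ snd G G)
    (hc : T.pr c = x ≫ μ[G]) (ha : T.pr a = x ≫ fst G G)

theorem delta1Sec_congr {T : Torsor F G} {x x' : U ⟶ G ⊗ G} {b c a b' c' a' : T.sec U}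
    (hb : T.pr b = x ≫ snd G G) (hc : T.pr c = x ≫ μ[G]) (ha : T.pr a = x ≫ fst G G)
    (ex : x = x') (eb : b = b') (ec : c = c') (ea : a = a') :
    delta1Sec T x b c a hb hc ha = delta1Sec T x' b' c' a' (by rw [← eb, ← ex, hb])
      (by rw [← ec, ← ex, hc]) (by rw [← ea, ← ex, ha]) := by
  subst ex eb ec ea
  rfl

theorem pr_delta1Sec : ((delta1 F G).obj T).pr (delta1Sec T x b c a hb hc ha) = x :=
  (pr_tmul _ _ _).trans (pr_tmul _ _ _)

theorem res_delta1Sec (g : V ⟶ U) :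
    ((delta1 F G).obj T).res g (delta1Sec T x b c a hb hc ha) =
      delta1Sec T (g ≫ x) (T.res g b) (T.res g c) (T.res g a)
        (by simp [hb]) (by simp [hc]) (by simp [ha]) := by
  exact (res_tmul _ _ _ _).trans (tmul_congr _ (res_tmul _ _ _ _) rfl)

theorem delta1Sec_smul (fb fc fa : F.obj.obj (op U)) :
    delta1Sec T x (fb • b) (fc • c) (fa • a) (by simp [hb]) (by simp [hc]) (by simp [ha]) =
      (fb * fc⁻¹ * fa) • delta1Sec T x b c a hb hc ha := by
  have e : dualSec _ (pullbackSec μ[G] T x (fc • c) (by simp [hc])) =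
      fc⁻¹ • dualSec _ (pullbackSec μ[G] T x c hc) := by
    rw [smul_dualSec, inv_inv, smul_pullbackSec]
  have h0 : (pullback (snd G G) T).pr (pullbackSec (snd G G) T x b hb) =
      (dual (pullback μ[G] T)).pr (dualSec _ (pullbackSec μ[G] T x c hc)) := by
    rw [pr_dualSec, pr_pullbackSec, pr_pullbackSec]
  have h1 := smul_tmul_smul fb fc⁻¹ _ _ h0
  exact (tmul_congr _ ((tmul_congr _ rfl e).trans h1) rfl).trans
    (smul_tmul_smul (fb * fc⁻¹) fa (tmul _ _ h0) (pullbackSec (fst G G) T x a ha)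
      (by rw [pr_tmul, pr_pullbackSec, pr_pullbackSec]))

theorem app_delta1_map {T' : Torsor F G} (φ : T ⟶ T') :
    app ((delta1 F G).map φ) (delta1Sec T x b c a hb hc ha) =
      delta1Sec T' x (app φ b) (app φ c) (app φ a) (by simp [hb]) (by simp [hc])
        (by simp [ha]) := by
  exact (app_tensorMap _ _ _ _ _).trans (tmul_congr _ (app_tensorMap _ _ _ _ _) rfl)

end

section
variable (P : Torsor F (G ⊗ G)) (x : U ⟶ G ⊗ G ⊗ G) (s₁ s₂ s₃ s₄ : P.sec U)
    (h₁ : P.pr s₁ = x ≫ p12 G) (h₂ : P.pr s₂ = x ≫ m01 G) (h₃ : P.pr s₃ = x ≫ m12 G)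
    (h₄ : P.pr s₄ = x ≫ p01 G)

theorem delta2Sec_congr {P : Torsor F (G ⊗ G)} {x : U ⟶ G ⊗ G ⊗ G}
    {s₁ s₂ s₃ s₄ s₁' s₂' s₃' s₄' : P.sec U}
    (h₁ : P.pr s₁ = x ≫ p12 G) (h₂ : P.pr s₂ = x ≫ m01 G) (h₃ : P.pr s₃ = x ≫ m12 G)
    (h₄ : P.pr s₄ = x ≫ p01 G) (e₁ : s₁ = s₁') (e₂ : s₂ = s₂') (e₃ : s₃ = s₃') (e₄ : s₄ = s₄') :
    delta2Sec P x s₁ s₂ s₃ s₄ h₁ h₂ h₃ h₄ = delta2Sec P x s₁' s₂' s₃' s₄' (by rw [← e₁, h₁])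
      (by rw [← e₂, h₂]) (by rw [← e₃, h₃]) (by rw [← e₄, h₄]) := by
  subst e₁ e₂ e₃ e₄
  rfl

theorem pr_delta2Sec :
    ((delta2 F G).obj P).pr (delta2Sec P x s₁ s₂ s₃ s₄ h₁ h₂ h₃ h₄) = x :=
  (pr_tmul _ _ _).trans ((pr_tmul _ _ _).trans (pr_tmul _ _ _))

theorem res_delta2Sec (g : V ⟶ U) :
    ((delta2 F G).obj P).res g (delta2Sec P x s₁ s₂ s₃ s₄ h₁ h₂ h₃ h₄) =
      delta2Sec P (g ≫ x) (P.res g s₁) (P.res g s₂) (P.res g s₃) (P.res g s₄)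
        (by simp [h₁]) (by simp [h₂]) (by simp [h₃]) (by simp [h₄]) := by
  exact (res_tmul _ _ _ _).trans (tmul_congr _ ((res_tmul _ _ _ _).trans
    (tmul_congr _ (res_tmul _ _ _ _) rfl)) rfl)

theorem delta2Sec_smul (f₁ f₂ f₃ f₄ : F.obj.obj (op U)) :
    delta2Sec P x (f₁ • s₁) (f₂ • s₂) (f₃ • s₃) (f₄ • s₄) (by simp [h₁]) (by simp [h₂])
      (by simp [h₃]) (by simp [h₄]) =
      (f₁ * f₂⁻¹ * f₃ * f₄⁻¹) • delta2Sec P x s₁ s₂ s₃ s₄ h₁ h₂ h₃ h₄ := by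
  have e₂ : dualSec _ (pullbackSec (m01 G) P x (f₂ • s₂) (by simp [h₂])) =
      f₂⁻¹ • dualSec _ (pullbackSec (m01 G) P x s₂ h₂) := by
    rw [smul_dualSec, inv_inv, smul_pullbackSec]
  have e₄ : dualSec _ (pullbackSec (p01 G) P x (f₄ • s₄) (by simp [h₄])) =
      f₄⁻¹ • dualSec _ (pullbackSec (p01 G) P x s₄ h₄) := by
    rw [smul_dualSec, inv_inv, smul_pullbackSec]
  have h0 : (pullback (p12 G) P).pr (pullbackSec (p12 G) P x s₁ h₁) =
      (dual (pullback (m01 G) P)).pr (dualSec _ (pullbackSec (m01 G) P x s₂ h₂)) := by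
    rw [pr_dualSec, pr_pullbackSec, pr_pullbackSec]
  have k0 := smul_tmul_smul f₁ f₂⁻¹ _ _ h0
  have h1 : (tensor _ _).pr (tmul _ _ h0) =
      (pullback (m12 G) P).pr (pullbackSec (m12 G) P x s₃ h₃) := by
    rw [pr_tmul, pr_pullbackSec, pr_pullbackSec]
  have k1 := smul_tmul_smul (f₁ * f₂⁻¹) f₃ _ _ h1
  exact (tmul_congr _ ((tmul_congr _ ((tmul_congr _ rfl e₂).trans k0) rfl).trans k1) e₄).trans
    (smul_tmul_smul (f₁ * f₂⁻¹ * f₃) f₄⁻¹ (tmul _ _ h1)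
      (dualSec _ (pullbackSec (p01 G) P x s₄ h₄))
      (by rw [pr_tmul, pr_tmul, pr_dualSec, pr_pullbackSec, pr_pullbackSec]))

theorem app_delta2_map {P' : Torsor F (G ⊗ G)} (φ : P ⟶ P') :
    app ((delta2 F G).map φ) (delta2Sec P x s₁ s₂ s₃ s₄ h₁ h₂ h₃ h₄) =
      delta2Sec P' x (app φ s₁) (app φ s₂) (app φ s₃) (app φ s₄) (by simp [h₁]) (by simp [h₂])
        (by simp [h₃]) (by simp [h₄]) := by
  exact (app_tensorMap _ _ _ _ _).trans (tmul_congr _ ((app_tensorMap _ _ _ _ _).trans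
    (tmul_congr _ (app_tensorMap _ _ _ _ _) rfl)) rfl)

end

variable (F G) in
/-- The canonical isomorphism `F_{G³} ≅ δ² F_{G²}`, sending `1` to `1 ⊗ 1^∨ ⊗ 1 ⊗ 1^∨`. -/
def delta2Trivial : trivial F (G ⊗ G ⊗ G) ≅ (delta2 F G).obj (trivial F (G ⊗ G)) :=
  trivialise _
    (fun x => delta2Sec _ x (trivialSec 1 (x ≫ p12 G)) (trivialSec 1 (x ≫ m01 G))
      (trivialSec 1 (x ≫ m12 G)) (trivialSec 1 (x ≫ p01 G)) rfl rfl rfl rfl)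
    (fun x => pr_delta2Sec _ _ _ _ _ _ _ _ _ _)
    (fun {U V} g x => by
      have e : ∀ a : U ⟶ G ⊗ G, (trivial F (G ⊗ G)).res g (trivialSec 1 a) =
          trivialSec 1 (g ≫ a) := fun a => Prod.ext (map_one (F.obj.map g.op).hom) rfl
      refine (res_delta2Sec _ _ _ _ _ _ _ _ _ _ g).trans (delta2Sec_congr _ _ _ _ ?_ ?_ ?_ ?_) <;>
        rw [e, Category.assoc])

/-- Sections of `T` over the points `a`, `b`, `c`, `ab`, `bc`, `abc` of `G`, where `x = (a, b, c)`
is a point of `G³`. -/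
structure Frame (T : Torsor F G) (x : U ⟶ G ⊗ G ⊗ G) where
  a : T.sec U
  b : T.sec U
  c : T.sec U
  ab : T.sec U
  bc : T.sec U
  abc : T.sec U
  ha : T.pr a = x ≫ p01 G ≫ fst G G
  hb : T.pr b = x ≫ p01 G ≫ snd G G
  hc : T.pr c = x ≫ p12 G ≫ snd G G
  hab : T.pr ab = x ≫ p01 G ≫ μ[G]
  hbc : T.pr bc = x ≫ p12 G ≫ μ[G]
  habc : T.pr abc = x ≫ m01 G ≫ μ[G]

namespace Frame

variable {T : Torsor F G} {x : U ⟶ G ⊗ G ⊗ G}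

/-- Restriction of frames. -/
def res (s : Frame T x) (g : V ⟶ U) : Frame T (g ≫ x) where
  a := T.res g s.a
  b := T.res g s.b
  c := T.res g s.c
  ab := T.res g s.ab
  bc := T.res g s.bc
  abc := T.res g s.abc
  ha := by simp [s.ha]
  hb := by simp [s.hb]
  hc := by simp [s.hc]
  hab := by simp [s.hab]
  hbc := by simp [s.hbc]
  habc := by simp [s.habc]

/-- The section
`(c ⊗ bc^∨ ⊗ b) ⊗ (c ⊗ abc^∨ ⊗ ab)^∨ ⊗ (bc ⊗ abc^∨ ⊗ a) ⊗ (b ⊗ ab^∨ ⊗ a)^∨` of `δ² δ¹ T`. -/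
def section₂ (s : Frame T x) : ((delta2 F G).obj ((delta1 F G).obj T)).sec U :=
  delta2Sec _ x
    (delta1Sec T (x ≫ p12 G) s.c s.bc s.b (by simp [s.hc]) (by simp [s.hbc])
      (by simp [s.hb, p12_fst]))
    (delta1Sec T (x ≫ m01 G) s.c s.abc s.ab (by simp [s.hc, m01_snd]) (by simp [s.habc])
      (by simp [s.hab, m01_fst]))
    (delta1Sec T (x ≫ m12 G) s.bc s.abc s.a (by simp [s.hbc, m12_snd])
      (by simp [s.habc, m12_mul]) (by simp [s.ha, m12_fst]))
    (delta1Sec T (x ≫ p01 G) s.b s.ab s.a (by simp [s.hb]) (by simp [s.hab]) (by simp [s.ha]))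
    (pr_delta1Sec _ _ _ _ _ _ _ _) (pr_delta1Sec _ _ _ _ _ _ _ _)
    (pr_delta1Sec _ _ _ _ _ _ _ _) (pr_delta1Sec _ _ _ _ _ _ _ _)

theorem res_section₂ (s : Frame T x) (g : V ⟶ U) :
    ((delta2 F G).obj ((delta1 F G).obj T)).res g s.section₂ = (s.res g).section₂ := by
  refine (res_delta2Sec _ _ _ _ _ _ _ _ _ _ g).trans (delta2Sec_congr _ _ _ _ ?_ ?_ ?_ ?_) <;>
    exact (res_delta1Sec _ _ _ _ _ _ _ _ g).trans
      (delta1Sec_congr _ _ _ (Category.assoc _ _ _).symm rfl rfl rfl)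

theorem scalar_eq_one {A : Type*} [CommGroup A] (a b c ab bc abc : A) :
    c * bc⁻¹ * b * (c * abc⁻¹ * ab)⁻¹ * (bc * abc⁻¹ * a) * (b * ab⁻¹ * a)⁻¹ = 1 := by
  apply Additive.ofMul.injective
  simp only [ofMul_mul, ofMul_inv, ofMul_one]
  abel

/-- The section of `δ² δ¹ T` does not depend on the chosen sections of `T`. -/
theorem section₂_eq (s s' : Frame T x) : s.section₂ = s'.section₂ := by
  obtain ⟨a, b, c, ab, bc, abc, ha, hb, hc, hab, hbc, habc⟩ := s
  obtain ⟨a', b', c', ab', bc', abc', ha', hb', hc', hab', hbc', habc'⟩ := s'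
  obtain ⟨fa, rfl⟩ := T.exists_smul (ha.trans ha'.symm)
  obtain ⟨fb, rfl⟩ := T.exists_smul (hb.trans hb'.symm)
  obtain ⟨fc, rfl⟩ := T.exists_smul (hc.trans hc'.symm)
  obtain ⟨fab, rfl⟩ := T.exists_smul (hab.trans hab'.symm)
  obtain ⟨fbc, rfl⟩ := T.exists_smul (hbc.trans hbc'.symm)
  obtain ⟨fabc, rfl⟩ := T.exists_smul (habc.trans habc'.symm)
  symm
  refine (delta2Sec_congr _ _ _ _
    (delta1Sec_smul T _ c bc b (by simp [hc]) (by simp [hbc]) (by simp [hb, p12_fst]) fc fbc fb)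
    (delta1Sec_smul T _ c abc ab (by simp [hc, m01_snd]) (by simp [habc]) (by simp [hab, m01_fst])
      fc fabc fab)
    (delta1Sec_smul T _ bc abc a (by simp [hbc, m12_snd]) (by simp [habc, m12_mul])
      (by simp [ha, m12_fst]) fbc fabc fa)
    (delta1Sec_smul T _ b ab a (by simp [hb]) (by simp [hab]) (by simp [ha]) fb fab fa)).trans ?_
  refine (delta2Sec_smul _ x _ _ _ _ (pr_delta1Sec ..) (pr_delta1Sec ..) (pr_delta1Sec ..)
    (pr_delta1Sec ..) _ _ _ _).trans ?_
  rw [scalar_eq_one]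
  exact MulAction.one_smul _

end Frame

theorem exists_local_frame (T : Torsor F G) (x : U ⟶ G ⊗ G ⊗ G) :
    ∃ R ∈ J U, ∀ ⦃V : C⦄ (g : V ⟶ U), R g → Nonempty (Frame T (g ≫ x)) := by
  obtain ⟨R₁, hR₁, H₁⟩ := T.local_sec (x ≫ p01 G ≫ fst G G)
  obtain ⟨R₂, hR₂, H₂⟩ := T.local_sec (x ≫ p01 G ≫ snd G G)
  obtain ⟨R₃, hR₃, H₃⟩ := T.local_sec (x ≫ p12 G ≫ snd G G)
  obtain ⟨R₄, hR₄, H₄⟩ := T.local_sec (x ≫ p01 G ≫ μ[G])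
  obtain ⟨R₅, hR₅, H₅⟩ := T.local_sec (x ≫ p12 G ≫ μ[G])
  obtain ⟨R₆, hR₆, H₆⟩ := T.local_sec (x ≫ m01 G ≫ μ[G])
  refine ⟨R₁ ⊓ (R₂ ⊓ (R₃ ⊓ (R₄ ⊓ (R₅ ⊓ R₆)))), J.intersection_covering hR₁
    (J.intersection_covering hR₂ (J.intersection_covering hR₃ (J.intersection_covering hR₄
      (J.intersection_covering hR₅ hR₆)))), fun V g hg => ?_⟩
  obtain ⟨a, ha⟩ := H₁ g hg.1
  obtain ⟨b, hb⟩ := H₂ g hg.2.1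
  obtain ⟨c, hc⟩ := H₃ g hg.2.2.1
  obtain ⟨ab, hab⟩ := H₄ g hg.2.2.2.1
  obtain ⟨bc, hbc⟩ := H₅ g hg.2.2.2.2.1
  obtain ⟨abc, habc⟩ := H₆ g hg.2.2.2.2.2
  exact ⟨⟨a, b, c, ab, bc, abc, by simp [ha], by simp [hb], by simp [hc], by simp [hab],
    by simp [hbc], by simp [habc]⟩⟩

theorem existsUnique_kappaSec (T : Torsor F G) (x : U ⟶ G ⊗ G ⊗ G) :
    ∃! k : ((delta2 F G).obj ((delta1 F G).obj T)).sec U,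
      ∀ ⦃V : C⦄ (g : V ⟶ U) (s : Frame T (g ≫ x)),
        ((delta2 F G).obj ((delta1 F G).obj T)).res g k = s.section₂ := by
  obtain ⟨R, hR, H⟩ := exists_local_frame T x
  obtain ⟨k, hk⟩ := glue ((delta2 F G).obj ((delta1 F G).obj T)) hR
    (fun V g k => ∃ s : Frame T (g ≫ x), k = s.section₂)
    (fun V W g h k ⟨s, hs⟩ => by
      subst hs
      rw [Frame.res_section₂]
      have e : h ≫ g ≫ x = (h ≫ g) ≫ x := (Category.assoc _ _ _).symm
      generalize s.res h = s'
      revert s'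
      rw [e]
      exact fun s' => ⟨s', rfl⟩)
    (fun V g k k' _ ⟨s, hs⟩ ⟨s', hs'⟩ => by rw [hs, hs', Frame.section₂_eq s s'])
    (fun V g hg => ⟨_, (H g hg).some, rfl⟩)
  refine ⟨k, fun V g s => ?_, fun k' hk' => sep _ hR fun V g hg => ?_⟩
  · refine sep _ (J.pullback_stable g hR) fun W h hh => ?_
    obtain ⟨s', hs'⟩ := hk (h ≫ g) hh
    rw [res_res, hs', Frame.res_section₂]
    have e : (h ≫ g) ≫ x = h ≫ g ≫ x := Category.assoc _ _ _
    generalize s.res h = s''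
    revert s''
    rw [← e]
    exact fun s'' => Frame.section₂_eq _ _
  · obtain ⟨s, hs⟩ := hk g hg
    rw [hs, hk' g s]

/-- The canonical section of `δ² δ¹ T`. -/
def kappaSec (T : Torsor F G) (x : U ⟶ G ⊗ G ⊗ G) :
    ((delta2 F G).obj ((delta1 F G).obj T)).sec U := (existsUnique_kappaSec T x).choose

theorem kappaSec_spec (T : Torsor F G) (x : U ⟶ G ⊗ G ⊗ G) (g : V ⟶ U) (s : Frame T (g ≫ x)) :
    ((delta2 F G).obj ((delta1 F G).obj T)).res g (kappaSec T x) = s.section₂ :=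
  (existsUnique_kappaSec T x).choose_spec.1 g s

theorem kappaSec_eq (T : Torsor F G) (x : U ⟶ G ⊗ G ⊗ G) (s : Frame T x) :
    kappaSec T x = s.section₂ := by
  have e : 𝟙 U ≫ x = x := Category.id_comp x
  rw [← res_id _ (kappaSec T x), kappaSec_spec T x (𝟙 U) (s.res (𝟙 U)), ← Frame.res_section₂,
    res_id]

theorem res_kappaSec (T : Torsor F G) (x : U ⟶ G ⊗ G ⊗ G) (g : V ⟶ U) :
    ((delta2 F G).obj ((delta1 F G).obj T)).res g (kappaSec T x) = kappaSec T (g ≫ x) := by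
  refine ((existsUnique_kappaSec T (g ≫ x)).unique (fun W h s => ?_)
    (fun W h s => kappaSec_spec T (g ≫ x) h s))
  have e : (h ≫ g) ≫ x = h ≫ g ≫ x := Category.assoc _ _ _
  rw [res_res]
  revert s
  rw [← e]
  exact fun s => kappaSec_spec T x (h ≫ g) s

theorem pr_kappaSec (T : Torsor F G) (x : U ⟶ G ⊗ G ⊗ G) :
    ((delta2 F G).obj ((delta1 F G).obj T)).pr (kappaSec T x) = x := by
  obtain ⟨R, hR, H⟩ := exists_local_frame T x
  refine hom_sep hR fun V g hg => ?_
  rw [← pr_res, res_kappaSec, kappaSec_eq T _ (H g hg).some]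
  exact pr_delta2Sec ..

/-- The canonical trivialisation `κ_T : F_{G³} ≅ δ² δ¹ T`: over a point `(a, b, c)` of `G³` it
sends `1` to
`(t_c ⊗ t_bc^∨ ⊗ t_b) ⊗ (t_c ⊗ t_abc^∨ ⊗ t_ab)^∨ ⊗ (t_bc ⊗ t_abc^∨ ⊗ t_a) ⊗ (t_b ⊗ t_ab^∨ ⊗ t_a)^∨`
for any local sections `t_a`, `t_b`, `t_c`, `t_ab`, `t_bc`, `t_abc` of `T` over the points `a`,
`b`, `c`, `ab`, `bc`, `abc` of `G`. -/
def kappa (T : Torsor F G) :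
    trivial F (G ⊗ G ⊗ G) ≅ (delta2 F G).obj ((delta1 F G).obj T) :=
  trivialise _ (fun x => kappaSec T x) (fun x => pr_kappaSec T x) (fun g x => res_kappaSec T x g)

variable (F G)

/-- An `F`-extension datum on `G`: an `F`-torsor `T` over `G` and a trivialisation
`τ : F_{G²} ≅ δ¹ T` such that `κ_T : F_{G³} ≅ δ² δ¹ T` is the composition of the canonical
isomorphism `F_{G³} ≅ δ² F_{G²}` with `δ² τ`. -/
structure ExtensionDatum where
  T : Torsor F G
  τ : trivial F (G ⊗ G) ≅ (delta1 F G).obj T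
  triangle : (delta2Trivial F G).hom ≫ (delta2 F G).map τ.hom = (kappa T).hom

variable {F G}

namespace ExtensionDatum

/-- An isomorphism `(T, τ) ⟶ (T', τ')` of extension data: an isomorphism `φ : T ≅ T'` of torsors
with `δ¹ φ ∘ τ = τ'`. -/
@[ext] structure Hom (D D' : ExtensionDatum F G) where
  φ : D.T ≅ D'.T
  triangle : D.τ.hom ≫ (delta1 F G).map φ.hom = D'.τ.hom

/-- The groupoid of `F`-extension data on `G`. -/
instance : Groupoid (ExtensionDatum F G) where
  Hom := Hom
  id D := ⟨Iso.refl _, by simp⟩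
  comp α β := ⟨α.φ ≪≫ β.φ, by
    rw [Iso.trans_hom, CategoryTheory.Functor.map_comp, ← Category.assoc, α.triangle, β.triangle]⟩
  inv α := ⟨α.φ.symm, by
    rw [← α.triangle, Category.assoc, ← Functor.map_comp, Iso.symm_hom, Iso.hom_inv_id,
      CategoryTheory.Functor.map_id, Category.comp_id]⟩
  id_comp α := Hom.ext (Iso.refl_trans _)
  comp_id α := Hom.ext (Iso.trans_refl _)
  assoc α β α' := Hom.ext (Iso.trans_assoc _ _ _)
  inv_comp α := Hom.ext (Iso.symm_self_id _)
  comp_inv α := Hom.ext (Iso.self_symm_id _)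

variable (F G) in
/-- The functor sending `(T, τ)` to `T`. -/
def forget : ExtensionDatum F G ⥤ Torsor F G where
  obj D := D.T
  map {D D'} α := (ExtensionDatum.Hom.φ (D := D) (D' := D') α).hom
  map_id _ := rfl
  map_comp _ _ := rfl

end ExtensionDatum

end Delta

/-! ### Central extensions -/

section CentralExtension

variable [CartesianMonoidalCategory C]
variable (F : Sheaf J CommGrpCat.{u + 1}) (G : C) [GrpObj G]

/-- A central extension `1 ⟶ F ⟶ E ⟶ G ⟶ 1` of sheaves of groups; `G` stands for the sheaf of
groups `U ↦ Hom(U, G)`, and surjectivity is surjectivity as a morphism of sheaves. -/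
structure CentralExtension where
  E : Sheaf J GrpCat.{u + 1}
  j : ∀ {U : C}, F.obj.obj (op U) →* E.obj.obj (op U)
  q : ∀ {U : C}, E.obj.obj (op U) →* (U ⟶ G)
  j_map : ∀ {U V : C} (g : V ⟶ U) (f : F.obj.obj (op U)),
    E.obj.map g.op (j f) = j (F.obj.map g.op f)
  q_map : ∀ {U V : C} (g : V ⟶ U) (x : E.obj.obj (op U)), q (E.obj.map g.op x) = g ≫ q x
  j_injective : ∀ {U : C}, Function.Injective (j : F.obj.obj (op U) →* E.obj.obj (op U))
  exact : ∀ {U : C} (x : E.obj.obj (op U)), q x = 1 ↔ ∃ f, j f = x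
  q_locally_surjective : ∀ {U : C} (a : U ⟶ G), ∃ R ∈ J U, ∀ ⦃V : C⦄ (g : V ⟶ U), R g →
    ∃ x : E.obj.obj (op V), q x = g ≫ a
  central : ∀ {U : C} (f : F.obj.obj (op U)) (x : E.obj.obj (op U)), j f * x = x * j f

variable {F G}

namespace CentralExtension

/-- Morphisms of central extensions of `G` by `F`: homomorphisms of sheaves of groups inducing the
identity on `F` and on `G`. -/
@[ext] structure Hom (E E' : CentralExtension F G) where
  hom : E.E ⟶ E'.E
  j_hom : ∀ {U : C} (f : F.obj.obj (op U)), hom.hom.app (op U) (E.j f) = E'.j f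
  q_hom : ∀ {U : C} (x : E.E.obj.obj (op U)), E'.q (hom.hom.app (op U) x) = E.q x

/-- The category of central extensions of `G` by `F`. -/
instance : Category (CentralExtension F G) where
  Hom := Hom
  id E := ⟨𝟙 _, fun _ => rfl, fun _ => rfl⟩
  comp α β := ⟨α.hom ≫ β.hom,
    fun f => (congrArg _ (α.j_hom f)).trans (β.j_hom f),
    fun x => (β.q_hom _).trans (α.q_hom x)⟩

/-- A central extension `E` as an `F`-torsor over `G`, with `f` acting as multiplication by
`j f`. -/
def toTorsor (E : CentralExtension F G) : Torsor F G where
  sheaf := (sheafCompose J (CategoryTheory.forget GrpCat.{u + 1})).obj E.E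
  proj {U} (x : E.E.obj.obj (op U)) := E.q x
  smul {U} f (x : E.E.obj.obj (op U)) := (E.j f * x : E.E.obj.obj (op U))
  proj_map g x := E.q_map g x
  smul_map {U V} g f x := by
    refine (map_mul (E.E.obj.map g.op).hom (E.j f) x).trans ?_
    exact congrArg (fun k : E.E.obj.obj (op V) => k * (E.E.obj.map g.op).hom x) (E.j_map g f)
  proj_smul {U} f x := by
    refine (map_mul E.q (E.j f) x).trans ?_
    exact (congrArg (fun k => k * E.q x) ((E.exact (E.j f)).2 ⟨f, rfl⟩)).trans (_root_.one_mul _)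
  one_smul {U} x := by
    change E.E.obj.obj (op U) at x
    exact (congrArg (· * x) (map_one E.j)).trans (_root_.one_mul x)
  mul_smul {U} f f' x := by
    change E.E.obj.obj (op U) at x
    exact (congrArg (· * x) (map_mul E.j f f')).trans (_root_.mul_assoc _ _ x)
  simply_transitive {U} x y h := by
    change E.E.obj.obj (op U) at x y
    change E.q x = E.q y at h
    obtain ⟨f, hf⟩ := (E.exact (y * x⁻¹)).1 (by rw [map_mul, map_inv, h, mul_inv_cancel])
    refine ⟨f, ?_, fun f' hf' => ?_⟩
    · change E.j f * x = y
      rw [hf, inv_mul_cancel_right]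
    · change E.j f' * x = y at hf'
      refine E.j_injective ?_
      rw [hf, ← hf', mul_inv_cancel_right]
  locally_nonempty a := E.q_locally_surjective a

/-- An element of `E` as a section of the torsor `E` over `G`. -/
def toSec (E : CentralExtension F G) {U : C} (x : E.E.obj.obj (op U)) : E.toTorsor.sec U := x

theorem pr_toSec (E : CentralExtension F G) {U : C} (x : E.E.obj.obj (op U)) :
    E.toTorsor.pr (E.toSec x) = E.q x := rfl

variable (F G) in
/-- The functor sending a central extension to its underlying `F`-torsor over `G`. -/
def torsor : CentralExtension F G ⥤ Torsor F G where
  obj E := E.toTorsor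
  map {E E'} α := Torsor.mkHom (T := E.toTorsor) (T' := E'.toTorsor)
    (fun {U} x => (Hom.hom α).hom.app (op U) x)
    (fun g x => (NatTrans.naturality_apply (Hom.hom α).hom g.op x).symm)
    (fun x => Hom.q_hom α x)
    (fun {U} f x => by
      refine (map_mul ((Hom.hom α).hom.app (op U)).hom (E.j f) x).trans ?_
      exact congrArg (· * ((Hom.hom α).hom.app (op U)).hom x) (Hom.j_hom α f))
  map_id _ := rfl
  map_comp _ _ := rfl

section
variable [J.Subcanonical]

/-- Let `E` be a central extension, `(T, τ)` an extension datum and `φ : E ⟶ T` an isomorphism of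
torsors. Via `φ`, the trivialisation `τ` is the one induced by the multiplication of `E`: over a
point `(q x, q y)` of `G²`, it sends `1` to `y ⊗ (x y)^∨ ⊗ x`. Equivalently, the isomorphism
`p₀^* T ⊗ p₁^* T ≅ m^* T` given by `τ` sends `φ x ⊗ φ y` to `φ (x y)`. -/
def InducesTrivialisation (E : CentralExtension F G) (D : ExtensionDatum F G)
    (φ : E.toTorsor ⟶ D.T) : Prop :=
  ∀ (U : C) (x y : E.E.obj.obj (op U)),
    app D.τ.hom (trivialSec 1 (lift (E.q x) (E.q y))) =
      delta1Sec D.T (lift (E.q x) (E.q y))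
        (app φ (E.toSec y)) (app φ (E.toSec (x * y))) (app φ (E.toSec x))
        (by rw [pr_app, pr_toSec, lift_snd])
        (by rw [pr_app, pr_toSec, map_mul, Hom.mul_def])
        (by rw [pr_app, pr_toSec, lift_fst])

end

end CentralExtension

end CentralExtension

end ExtData

/-! ### Group schemes -/

namespace ExtData

open AlgebraicGeometry

/-- The big fppf site of a scheme `S`. -/
abbrev fppf (S : Scheme.{u}) : GrothendieckTopology (Over S) := Scheme.fppfTopology.over S

/-- The sheaf `F` of abelian groups on the big fppf site of `S` is representable by a scheme that
is fppf and affine over `S`. (Surjectivity onto `S` is automatic because of the unit section, and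
finite presentation follows from local finite presentation for affine morphisms.) -/
def IsRepresentableFppfAffine {S : Scheme.{u}} (F : Sheaf (fppf S) CommGrpCat.{u + 1}) : Prop :=
  ∃ Y : Over S, Nonempty ((underlying F).obj.RepresentableBy Y) ∧
    Flat Y.hom ∧ LocallyOfFinitePresentation Y.hom ∧ IsAffineHom Y.hom

end ExtData

end

/-!
A trivialisation `τ` of `δ¹ T` is a composition law on `T` lying over that of `G` and compatible
with the action of `F` in both variables: `z` is the product of `x` and `y` when `τ` sends `1` to
`y ⊗ z^∨ ⊗ x`. Computing `δ² τ` with the local sections `x, y, z, xy, yz, (xy)z` of `T` shows that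
`δ² τ = κ` says exactly that this law is associative. An associative law of this kind is
automatically a group law: a unit and inverses exist locally because `F` acts simply transitively
on the fibres of `T`, they are unique, and hence they glue. Conversely, in a central extension the
section `y ⊗ (xy)^∨ ⊗ x` depends only on the images of `x` and `y` in `G`, so these sections glue to
a trivialisation. Morphisms on both sides are the multiplicative morphisms of torsors.
-/

noncomputable section

namespace ExtData

open ExtData.Torsor (app app_comp app_smul pr_app res_app trivial trivialSec trivialise)

variable {C : Type (u + 1)} [Category.{u} C] {J : GrothendieckTopology C}
variable {F : Sheaf J CommGrpCat.{u + 1}} {U V : C}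

namespace Torsor

section

variable {X : C}

theorem existsUnique_smul_eq {T : Torsor F X} {t t' : T.sec U} (h : T.pr t = T.pr t') :
    ∃! f : F.obj.obj (op U), f • t = t' :=
  T.simply_transitive t t' h

theorem smul_eq_self {T : Torsor F X} {f : F.obj.obj (op U)} {t : T.sec U} :
    f • t = t ↔ f = 1 :=
  ⟨fun h => T.smul_inj (h.trans (MulAction.one_smul t).symm), fun h => h ▸ MulAction.one_smul t⟩

/-- A morphism of torsors which is multiplicative for composition laws on their sections. -/
def IsMultiplicative {T T' : Torsor F X} [∀ U, Mul (T.sec U)] [∀ U, Mul (T'.sec U)]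
    (φ : T ⟶ T') : Prop :=
  ∀ ⦃U : C⦄ (x y : T.sec U), app φ (x * y) = app φ x * app φ y

namespace IsMultiplicative

variable {T T' T'' : Torsor F X} [∀ U, Mul (T.sec U)] [∀ U, Mul (T'.sec U)]
  [∀ U, Mul (T''.sec U)]

theorem comp {φ : T ⟶ T'} {ψ : T' ⟶ T''} (hφ : IsMultiplicative φ) (hψ : IsMultiplicative ψ) :
    IsMultiplicative (φ ≫ ψ) := fun U x y => by
  rw [app_comp, hφ, hψ, app_comp, app_comp]

theorem inv {φ : T ⟶ T'} [IsIso φ] (hφ : IsMultiplicative φ) :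
    IsMultiplicative (CategoryTheory.inv φ) := by
  have app_inv_app {U : C} (x : T.sec U) : app (CategoryTheory.inv φ) (app φ x) = x := by
    rw [← app_comp, IsIso.hom_inv_id, app_id]
  have app_app_inv {U : C} (x : T'.sec U) : app φ (app (CategoryTheory.inv φ) x) = x := by
    rw [← app_comp, IsIso.inv_hom_id, app_id]
  intro U x y
  conv_lhs => rw [← app_app_inv x, ← app_app_inv y, ← hφ, app_inv_app]

end IsMultiplicative

variable [J.Subcanonical]

theorem existsUnique_of_existsUnique_smul (T : Torsor F X) (x : U ⟶ X)
    (p : ∀ ⦃V : C⦄, (V ⟶ U) → T.sec V → Prop)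
    (hres : ∀ ⦃V W : C⦄ (g : V ⟶ U) (h : W ⟶ V) (t : T.sec V), p g t → p (h ≫ g) (T.res h t))
    (hpr : ∀ ⦃V : C⦄ (g : V ⟶ U) (t : T.sec V), p g t → T.pr t = g ≫ x)
    (hsmul : ∀ ⦃V : C⦄ (g : V ⟶ U) (t : T.sec V), T.pr t = g ≫ x →
      ∃! f : F.obj.obj (op V), p g (f • t)) :
    ∃! t, p (𝟙 U) t := by
  have huniq : ∀ ⦃V : C⦄ (g : V ⟶ U) (t t' : T.sec V), p g t → p g t' → t = t' := by
    intro V g t t' ht ht'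
    obtain ⟨f, rfl⟩ := T.exists_smul ((hpr g t ht).trans (hpr g t' ht').symm)
    have hf : f = 1 := (hsmul g t (hpr g t ht)).unique ht' (by rwa [MulAction.one_smul])
    rw [hf, MulAction.one_smul]
  obtain ⟨R, hR, hx⟩ := T.local_sec x
  obtain ⟨t, ht⟩ := T.glue hR p hres (fun V g t t' _ => huniq g t t') fun V g hg =>
    let ⟨s, hs⟩ := hx g hg
    let ⟨f, hf⟩ := (hsmul g s hs).exists
    ⟨f • s, hf⟩
  have htx : T.pr t = 𝟙 U ≫ x := hom_sep hR fun V g hg => by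
    rw [← pr_res, hpr g _ (ht g hg), Category.id_comp]
  obtain ⟨f, hf⟩ := (hsmul (𝟙 U) t htx).exists
  have hft : f • t = t := T.sep hR fun V g hg =>
    huniq g _ _ (by simpa only [Category.comp_id] using hres (𝟙 U) g _ hf) (ht g hg)
  exact ⟨t, hft ▸ hf, fun t' ht' => huniq (𝟙 U) t' t ht' (hft ▸ hf)⟩

theorem trivial_hom_ext {P : Torsor F X} {φ ψ : trivial F X ⟶ P}
    (h : ∀ (U : C) (x : U ⟶ X), app φ (trivialSec 1 x) = app ψ (trivialSec 1 x)) : φ = ψ := by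
  refine hom_ext fun U t => ?_
  have ht : t = (t.1 : F.obj.obj (op U)) • trivialSec (F := F) 1 t.2 :=
    Prod.ext (_root_.mul_one _).symm rfl
  rw [ht, app_smul, app_smul, h]

theorem res_trivialSec_one (g : V ⟶ U) (x : U ⟶ X) :
    (trivial F X).res g (trivialSec 1 x) = trivialSec 1 (g ≫ x) :=
  Prod.ext (map_one (F.obj.map g.op).hom) rfl

theorem trivial_hom_ext_of_local {P : Torsor F X} {φ ψ : trivial F X ⟶ P}
    (h : ∀ (U : C) (x : U ⟶ X), ∃ R ∈ J U, ∀ ⦃V : C⦄ (g : V ⟶ U), R g →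
      app φ (trivialSec 1 (g ≫ x)) = app ψ (trivialSec 1 (g ≫ x))) : φ = ψ := by
  refine trivial_hom_ext fun U x => ?_
  obtain ⟨R, hR, hx⟩ := h U x
  refine P.sep hR fun V g hg => ?_
  rw [res_app, res_app, res_trivialSec_one, hx g hg]

theorem exists_trivialisation (P : Torsor F X) (p : ∀ ⦃U : C⦄, P.sec U → Prop)
    (hres : ∀ ⦃U V : C⦄ (g : V ⟶ U) (s : P.sec U), p s → p (P.res g s))
    (huniq : ∀ ⦃U : C⦄ (s s' : P.sec U), p s → p s' → P.pr s = P.pr s' → s = s')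
    (hex : ∀ ⦃U : C⦄ (x : U ⟶ X), ∃ R ∈ J U, ∀ ⦃V : C⦄ (g : V ⟶ U), R g →
      ∃ s, p s ∧ P.pr s = g ≫ x) :
    ∃ φ : trivial F X ≅ P, ∀ ⦃U : C⦄ (s : P.sec U), p s →
      app φ.hom (trivialSec 1 (P.pr s)) = s := by
  have hglue : ∀ ⦃U : C⦄ (x : U ⟶ X), ∃ s : P.sec U, P.pr s = x ∧
      ∀ ⦃V : C⦄ (g : V ⟶ U) (s' : P.sec V), p s' → P.pr s' = g ≫ x → P.res g s = s' := by
    intro U x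
    obtain ⟨R, hR, hx⟩ := hex x
    obtain ⟨s, hs⟩ := P.glue hR (fun V g s => p s ∧ P.pr s = g ≫ x)
      (fun V W g h s hs => ⟨hres h s hs.1, by rw [pr_res, hs.2, Category.assoc]⟩)
      (fun V g s s' _ hs hs' => huniq s s' hs.1 hs'.1 (hs.2.trans hs'.2.symm)) hx
    refine ⟨s, hom_sep hR fun V g hg => by rw [← pr_res, (hs g hg).2], fun V g s' hs' hpr => ?_⟩
    refine P.sep (J.pullback_stable g hR) fun W h hh => ?_
    rw [res_res]
    exact huniq _ _ (hs _ hh).1 (hres h s' hs')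
      (by rw [(hs _ hh).2, pr_res, hpr, Category.assoc])
  choose s hs hsp using hglue
  have res_s : ∀ {U V : C} (g : V ⟶ U) (x : U ⟶ X), P.res g (s x) = s (g ≫ x) := by
    intro U V g x
    obtain ⟨R, hR, hx⟩ := hex (g ≫ x)
    refine P.sep hR fun W h hh => ?_
    obtain ⟨s', hs', hpr⟩ := hx h hh
    rw [res_res, hsp x (h ≫ g) s' hs' (by rw [hpr, Category.assoc]), hsp (g ≫ x) h s' hs' hpr]
  refine ⟨trivialise P (fun x => s x) (fun x => hs x) res_s, fun U s' hs' => ?_⟩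
  have hss' : s (P.pr s') = s' := by
    rw [← P.res_id (s _), hsp _ (𝟙 U) s' hs' (Category.id_comp _).symm]
  exact (MulAction.one_smul _).trans hss'

end

theorem exists_local_lift_pr [CartesianMonoidalCategory C] {X Y : C} (T : Torsor F X)
    (T' : Torsor F Y) (a : U ⟶ X ⊗ Y) :
    ∃ R ∈ J U, ∀ ⦃V : C⦄ (g : V ⟶ U), R g →
      ∃ x y, lift (T.pr (U := V) x) (T'.pr y) = g ≫ a := by
  obtain ⟨R, hR, hx⟩ := T.local_sec (a ≫ fst X Y)
  obtain ⟨R', hR', hy⟩ := T'.local_sec (a ≫ snd X Y)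
  refine ⟨_, J.intersection_covering hR hR', fun V g hg => ?_⟩
  obtain ⟨x, hx⟩ := hx g hg.1
  obtain ⟨y, hy⟩ := hy g hg.2
  exact ⟨x, y, by rw [hx, hy, ← comp_lift, lift_comp_fst_snd]⟩

end Torsor

variable [CartesianMonoidalCategory C] {G : C} [GrpObj G]

open ExtData.Torsor (IsMultiplicative)

namespace CentralExtension

variable (E : CentralExtension F G)

instance : Group (E.toTorsor.sec U) :=
  inferInstanceAs (Group (E.E.obj.obj (op U)))

instance : IsScalarTower (F.obj.obj (op U)) (E.toTorsor.sec U) (E.toTorsor.sec U) where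
  smul_assoc f (x y : E.E.obj.obj (op U)) := _root_.mul_assoc (E.j f) x y

instance : SMulCommClass (F.obj.obj (op U)) (E.toTorsor.sec U) (E.toTorsor.sec U) where
  smul_comm f (x y : E.E.obj.obj (op U)) := show E.j f * (x * y) = x * (E.j f * y) by
    rw [← _root_.mul_assoc, E.central, _root_.mul_assoc]

theorem pr_mul (x y : E.toTorsor.sec U) :
    E.toTorsor.pr (x * y) = E.toTorsor.pr x * E.toTorsor.pr y :=
  map_mul E.q x y

theorem res_mul (g : V ⟶ U) (x y : E.toTorsor.sec U) :
    E.toTorsor.res g (x * y) = E.toTorsor.res g x * E.toTorsor.res g y :=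
  map_mul (E.E.obj.map g.op).hom x y

theorem toSec_j (f : F.obj.obj (op U)) : E.toSec (E.j f) = f • (1 : E.toTorsor.sec U) :=
  (_root_.mul_one (E.j f)).symm

variable {E} {E' : CentralExtension F G}

/-- The morphism of central extensions defined by a multiplicative morphism of torsors. -/
def homOfIsMultiplicative (φ : E.toTorsor ⟶ E'.toTorsor) (hφ : IsMultiplicative φ) : E ⟶ E' :=
  let ψ (U : C) : E.toTorsor.sec U →* E'.toTorsor.sec U := MonoidHom.mk' (app φ) (@hφ U)
  Hom.mk
    ⟨{ app U := GrpCat.ofHom (ψ U.unop)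
       naturality _ _ g := by
        ext x
        exact (res_app φ g.unop x).symm }⟩
    (fun {U} f => show app φ (E.toSec (E.j f)) = E'.toSec (E'.j f) by
      rw [toSec_j, toSec_j, app_smul]
      exact congrArg (f • ·) (ψ U).map_one)
    (fun x => pr_app φ x)

theorem isMultiplicative_torsor_map (α : E ⟶ E') :
    IsMultiplicative (T := E.toTorsor) (T' := E'.toTorsor) ((torsor F G).map α) :=
  fun U x y => map_mul ((Hom.hom α).hom.app (op U)).hom x y

instance : (torsor F G).Faithful where
  map_injective {E E'} α β h := Hom.ext <| Sheaf.hom_ext <| by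
    ext U x
    exact congrArg (fun φ : E.toTorsor ⟶ E'.toTorsor => app φ x) h

instance isIso_hom (α : E ⟶ E') : IsIso α := by
  let φ : E.toTorsor ⟶ E'.toTorsor := (torsor F G).map α
  have : IsIso φ := Torsor.isIso_hom φ
  exact ⟨homOfIsMultiplicative (inv φ) (isMultiplicative_torsor_map α).inv,
    (torsor F G).map_injective (IsIso.hom_inv_id φ),
    (torsor F G).map_injective (IsIso.inv_hom_id φ)⟩

end CentralExtension

variable [J.Subcanonical]

section

variable (T : Torsor F G) (a : U ⟶ G ⊗ G) (b c d : T.sec U) (hb : T.pr b = a ≫ snd G G)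
  (hc : T.pr c = a ≫ μ[G]) (hd : T.pr d = a ≫ fst G G)

theorem delta1Sec_smul_middle (f : F.obj.obj (op U)) :
    delta1Sec T a b (f • c) d hb (by rw [Torsor.pr_smul, hc]) hd =
      f⁻¹ • delta1Sec T a b c d hb hc hd := by
  have h := delta1Sec_smul T a b c d hb hc hd 1 f 1
  rw [_root_.one_mul, _root_.mul_one] at h
  exact (delta1Sec_congr _ _ _ rfl (MulAction.one_smul b).symm rfl
    (MulAction.one_smul d).symm).trans h

theorem delta1Sec_smul_mul_smul (f f' : F.obj.obj (op U)) :
    delta1Sec T a (f' • b) ((f * f') • c) (f • d) (by rw [Torsor.pr_smul, hb])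
      (by rw [Torsor.pr_smul, hc]) (by rw [Torsor.pr_smul, hd]) = delta1Sec T a b c d hb hc hd := by
  refine (delta1Sec_smul T a b c d hb hc hd f' (f * f') f).trans ?_
  rw [Torsor.smul_eq_self, mul_comm f, mul_inv, mul_inv_cancel_left, inv_mul_cancel]

end

theorem delta2Sec_third_inj (P : Torsor F (G ⊗ G)) (x : U ⟶ G ⊗ G ⊗ G)
    (s₁ s₂ s₃ s₃' s₄ : P.sec U) (h₁ : P.pr s₁ = x ≫ p12 G) (h₂ : P.pr s₂ = x ≫ m01 G)
    (h₃ : P.pr s₃ = x ≫ m12 G) (h₃' : P.pr s₃' = x ≫ m12 G) (h₄ : P.pr s₄ = x ≫ p01 G) :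
    delta2Sec P x s₁ s₂ s₃ s₄ h₁ h₂ h₃ h₄ = delta2Sec P x s₁ s₂ s₃' s₄ h₁ h₂ h₃' h₄ ↔
      s₃ = s₃' := by
  refine ⟨fun h => ?_, fun h => delta2Sec_congr _ _ _ _ rfl rfl h rfl⟩
  obtain ⟨f, rfl⟩ := P.exists_smul (h₃.trans h₃'.symm)
  have hf := delta2Sec_smul P x s₁ s₂ s₃ s₄ h₁ h₂ h₃ h₄ 1 1 f 1
  rw [inv_one, _root_.mul_one, _root_.mul_one, _root_.one_mul] at hf
  have h' : f • delta2Sec P x s₁ s₂ s₃ s₄ h₁ h₂ h₃ h₄ = delta2Sec P x s₁ s₂ s₃ s₄ h₁ h₂ h₃ h₄ :=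
    hf.symm.trans ((delta2Sec_congr _ _ _ _ (MulAction.one_smul _) (MulAction.one_smul _) rfl
      (MulAction.one_smul _)).trans h.symm)
  rw [Torsor.smul_eq_self.1 h', MulAction.one_smul]

/-- `z` is the product of `x` and `y` in the composition law on `T` defined by `τ`: over the point
`(pr x, pr y)` of `G²`, the trivialisation `τ` sends `1` to `y ⊗ z^∨ ⊗ x`. -/
def IsProduct {T : Torsor F G} (τ : trivial F (G ⊗ G) ⟶ (delta1 F G).obj T) (x y z : T.sec U) :
    Prop :=
  ∃ h : T.pr z = T.pr x * T.pr y, app τ (trivialSec 1 (lift (T.pr x) (T.pr y))) =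
    delta1Sec T (lift (T.pr x) (T.pr y)) y z x (by rw [lift_snd]) h (by rw [lift_fst])

theorem isProduct_iff {T : Torsor F G} {τ : trivial F (G ⊗ G) ⟶ (delta1 F G).obj T}
    {x y z : T.sec U} {a : U ⟶ G ⊗ G} (hy : T.pr y = a ≫ snd G G) (hz : T.pr z = a ≫ μ[G])
    (hx : T.pr x = a ≫ fst G G) :
    IsProduct τ x y z ↔ app τ (trivialSec 1 a) = delta1Sec T a y z x hy hz hx := by
  obtain rfl : a = lift (T.pr x) (T.pr y) :=
    CartesianMonoidalCategory.hom_ext _ _ (by rw [hx, lift_fst]) (by rw [hy, lift_snd])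
  exact ⟨fun ⟨_, h⟩ => h, fun h => ⟨hz, h⟩⟩

namespace IsProduct

variable {T : Torsor F G} {τ : trivial F (G ⊗ G) ⟶ (delta1 F G).obj T} {x y z : T.sec U}

theorem pr_eq (h : IsProduct τ x y z) : T.pr z = T.pr x * T.pr y := h.1

theorem pr_eq_comp (h : IsProduct τ x y z) {a : U ⟶ G ⊗ G} (hx : T.pr x = a ≫ fst G G)
    (hy : T.pr y = a ≫ snd G G) : T.pr z = a ≫ μ := by
  rw [h.pr_eq, hx, hy, ← comp_mul, ← mul_eq_mul]

theorem res (h : IsProduct τ x y z) (g : V ⟶ U) :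
    IsProduct τ (T.res g x) (T.res g y) (T.res g z) := by
  obtain ⟨hz, h⟩ := h
  refine (isProduct_iff _ _ _).2 (Eq.trans ?_
    (res_delta1Sec T _ y z x (lift_snd _ _).symm hz (lift_fst _ _).symm g))
  rw [← h, res_app, Torsor.res_trivialSec_one]

theorem smul (h : IsProduct τ x y z) (f f' : F.obj.obj (op U)) :
    IsProduct τ (f • x) (f' • y) ((f * f') • z) :=
  (isProduct_iff _ _ _).2 (h.2.trans (delta1Sec_smul_mul_smul T _ y z x _ _ _ f f').symm)

theorem map {T' : Torsor F G} {τ' : trivial F (G ⊗ G) ⟶ (delta1 F G).obj T'} {φ : T ⟶ T'}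
    (hφ : τ ≫ (delta1 F G).map φ = τ') (h : IsProduct τ x y z) :
    IsProduct τ' (app φ x) (app φ y) (app φ z) := by
  subst hφ
  refine (isProduct_iff _ _ _).2 (Eq.trans ?_
    (app_delta1_map T _ y z x (lift_snd _ _).symm h.1 (lift_fst _ _).symm φ))
  rw [← h.2, app_comp]

theorem existsUnique_smul (τ : trivial F (G ⊗ G) ⟶ (delta1 F G).obj T)
    (h : T.pr z = T.pr x * T.pr y) :
    ∃! f : F.obj.obj (op U), IsProduct τ x y (f • z) := by
  let a := lift (T.pr x) (T.pr y)
  let s := delta1Sec T a y z x (by rw [lift_snd]) h (by rw [lift_fst])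
  have hs (f : F.obj.obj (op U)) :
      IsProduct τ x y (f • z) ↔ f⁻¹ • s = app τ (trivialSec 1 a) := by
    rw [isProduct_iff (a := a) (lift_snd _ _).symm (by rw [Torsor.pr_smul]; exact h)
      (lift_fst _ _).symm, delta1Sec_smul_middle T a y z x _ h, eq_comm]
  obtain ⟨f, hf, huniq⟩ := Torsor.existsUnique_smul_eq
    ((pr_delta1Sec T a y z x _ h _).trans (pr_app τ (trivialSec 1 a)).symm)
  refine ⟨f⁻¹, (hs _).2 (by rwa [inv_inv]), fun f' hf' => ?_⟩
  rw [← huniq _ ((hs f').1 hf'), inv_inv]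

theorem existsUnique (τ : trivial F (G ⊗ G) ⟶ (delta1 F G).obj T) (x y : T.sec U) :
    ∃! z, IsProduct τ x y z := by
  simpa only [Torsor.res_id] using T.existsUnique_of_existsUnique_smul (T.pr x * T.pr y)
    (fun _ g z => IsProduct τ (T.res g x) (T.res g y) z)
    (fun _ _ g h z hz => by simpa only [Torsor.res_res] using hz.res h)
    (fun _ g z hz => by rw [hz.pr_eq, Torsor.pr_res, Torsor.pr_res, comp_mul])
    (fun _ g z hz => existsUnique_smul τ (by rw [hz, comp_mul, Torsor.pr_res, Torsor.pr_res]))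

end IsProduct

theorem comp_delta1_map_eq_iff {T T' : Torsor F G} {τ : trivial F (G ⊗ G) ⟶ (delta1 F G).obj T}
    {τ' : trivial F (G ⊗ G) ⟶ (delta1 F G).obj T'} {φ : T ⟶ T'} :
    τ ≫ (delta1 F G).map φ = τ' ↔ ∀ {U : C} {x y z : T.sec U}, IsProduct τ x y z →
      IsProduct τ' (app φ x) (app φ y) (app φ z) := by
  refine ⟨fun hφ _ _ _ _ => IsProduct.map hφ, fun h => ?_⟩
  refine Torsor.trivial_hom_ext_of_local fun U a => ?_
  obtain ⟨R, hR, hxy⟩ := T.exists_local_lift_pr T a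
  refine ⟨R, hR, fun V g hg => ?_⟩
  obtain ⟨x, y, ha⟩ := hxy g hg
  obtain ⟨z, hz⟩ := (IsProduct.existsUnique τ x y).exists
  have hφx : T'.pr (app φ x) = (g ≫ a) ≫ fst G G := by rw [pr_app, ← ha, lift_fst]
  have hφy : T'.pr (app φ y) = (g ≫ a) ≫ snd G G := by rw [pr_app, ← ha, lift_snd]
  have hφz := (h hz).pr_eq_comp hφx hφy
  exact ((isProduct_iff hφy hφz hφx).1 (hz.map rfl)).trans
    ((isProduct_iff hφy hφz hφx).1 (h hz)).symm

section Associativity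

variable {T : Torsor F G} (τ : trivial F (G ⊗ G) ⟶ (delta1 F G).obj T)

theorem app_delta2Trivial_comp_delta2_map (p : U ⟶ G ⊗ G ⊗ G) :
    app ((delta2Trivial F G).hom ≫ (delta2 F G).map τ) (trivialSec 1 p) =
      delta2Sec _ p (app τ (trivialSec 1 (p ≫ p12 G))) (app τ (trivialSec 1 (p ≫ m01 G)))
        (app τ (trivialSec 1 (p ≫ m12 G))) (app τ (trivialSec 1 (p ≫ p01 G)))
        (pr_app _ _) (pr_app _ _) (pr_app _ _) (pr_app _ _) := by
  rw [app_comp, delta2Trivial, Torsor.app_trivialise, MulAction.one_smul]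
  exact app_delta2_map _ p _ _ _ _ rfl rfl rfl rfl τ

theorem app_kappa {p : U ⟶ G ⊗ G ⊗ G} (s : Frame T p) :
    app (kappa T).hom (trivialSec 1 p) = s.section₂ :=
  (MulAction.one_smul _).trans (kappaSec_eq T p s)

theorem app_delta2_map_eq_app_kappa_iff {p : U ⟶ G ⊗ G ⊗ G} {x y z xy yz w : T.sec U}
    (hx : T.pr x = p ≫ p01 G ≫ fst G G) (hy : T.pr y = p ≫ p01 G ≫ snd G G)
    (hz : T.pr z = p ≫ p12 G ≫ snd G G) (hxy : IsProduct τ x y xy) (hyz : IsProduct τ y z yz)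
    (hw : IsProduct τ xy z w) :
    app ((delta2Trivial F G).hom ≫ (delta2 F G).map τ) (trivialSec 1 p) =
      app (kappa T).hom (trivialSec 1 p) ↔ IsProduct τ x yz w := by
  have hx' : T.pr x = (p ≫ p01 G) ≫ fst G G := by rw [hx, Category.assoc]
  have hy' : T.pr y = (p ≫ p01 G) ≫ snd G G := by rw [hy, Category.assoc]
  have hy'' : T.pr y = (p ≫ p12 G) ≫ fst G G := by rw [hy, Category.assoc, p12_fst]
  have hz' : T.pr z = (p ≫ p12 G) ≫ snd G G := by rw [hz, Category.assoc]
  have hz'' : T.pr z = (p ≫ m01 G) ≫ snd G G := by rw [hz, Category.assoc, m01_snd]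
  have pr_xy := hxy.pr_eq_comp hx' hy'
  have pr_yz := hyz.pr_eq_comp hy'' hz'
  have pr_xy' : T.pr xy = (p ≫ m01 G) ≫ fst G G := by
    rw [pr_xy, Category.assoc, Category.assoc, m01_fst]
  have pr_w := hw.pr_eq_comp pr_xy' hz''
  let s : Frame T p := ⟨x, y, z, xy, yz, w, hx, hy, hz, by rw [pr_xy, Category.assoc],
    by rw [pr_yz, Category.assoc], by rw [pr_w, Category.assoc]⟩
  rw [app_delta2Trivial_comp_delta2_map, app_kappa s,
    isProduct_iff (a := p ≫ m12 G) (by rw [pr_yz, Category.assoc, Category.assoc, m12_snd])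
      (by rw [pr_w, Category.assoc, Category.assoc, m12_mul]) (by rw [hx, Category.assoc, m12_fst])]
  exact (Eq.congr_left (delta2Sec_congr _ _ _ _ ((isProduct_iff hz' pr_yz hy'').1 hyz)
    ((isProduct_iff hz'' pr_w pr_xy').1 hw) rfl ((isProduct_iff hy' pr_xy hx').1 hxy))).trans
    (delta2Sec_third_inj ..)

theorem delta2_map_eq_kappa_iff :
    (delta2Trivial F G).hom ≫ (delta2 F G).map τ = (kappa T).hom ↔
      ∀ {U : C} {x y z xy yz w : T.sec U}, IsProduct τ x y xy → IsProduct τ y z yz →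
        IsProduct τ xy z w → IsProduct τ x yz w := by
  constructor
  · intro h U x y z xy yz w hxy hyz hw
    refine (app_delta2_map_eq_app_kappa_iff τ (p := lift (T.pr x) (lift (T.pr y) (T.pr z)))
      ?_ ?_ ?_ hxy hyz hw).1 (by rw [h])
    all_goals simp [p01, p12]
  · intro h
    refine Torsor.trivial_hom_ext_of_local fun U p => ?_
    obtain ⟨R, hR, hs⟩ := exists_local_frame T p
    refine ⟨R, hR, fun V g hg => ?_⟩
    obtain ⟨x, y, z, -, -, -, hx, hy, hz, -, -, -⟩ := hs g hg
    obtain ⟨xy, hxy⟩ := (IsProduct.existsUnique τ x y).exists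
    obtain ⟨yz, hyz⟩ := (IsProduct.existsUnique τ y z).exists
    obtain ⟨w, hw⟩ := (IsProduct.existsUnique τ xy z).exists
    exact (app_delta2_map_eq_app_kappa_iff τ (by rw [hx, Category.assoc])
      (by rw [hy, Category.assoc]) (by rw [hz, Category.assoc]) hxy hyz hw).2 (h hxy hyz hw)

end Associativity

namespace ExtensionDatum

variable (D : ExtensionDatum F G)

/-- The composition law on the sections of `T` defined by `τ`. -/
instance : Mul (D.T.sec U) where
  mul x y := (IsProduct.existsUnique D.τ.hom x y).choose

theorem isProduct_iff_mul_eq {x y z : D.T.sec U} : IsProduct D.τ.hom x y z ↔ x * y = z :=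
  have h := (IsProduct.existsUnique D.τ.hom x y).choose_spec
  ⟨fun hz => (h.2 z hz).symm, fun hz => hz ▸ h.1⟩

theorem isProduct_mul (x y : D.T.sec U) : IsProduct D.τ.hom x y (x * y) :=
  D.isProduct_iff_mul_eq.2 rfl

theorem pr_mul (x y : D.T.sec U) : D.T.pr (x * y) = D.T.pr x * D.T.pr y :=
  (D.isProduct_mul x y).pr_eq

theorem res_mul (g : V ⟶ U) (x y : D.T.sec U) :
    D.T.res g (x * y) = D.T.res g x * D.T.res g y :=
  (D.isProduct_iff_mul_eq.1 ((D.isProduct_mul x y).res g)).symm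

instance : IsScalarTower (F.obj.obj (op U)) (D.T.sec U) (D.T.sec U) where
  smul_assoc f x y := D.isProduct_iff_mul_eq.1 <| show IsProduct _ _ _ (f • (x * y)) by
    simpa only [MulAction.one_smul, _root_.mul_one] using (D.isProduct_mul x y).smul f 1

instance : SMulCommClass (F.obj.obj (op U)) (D.T.sec U) (D.T.sec U) where
  smul_comm f x y := Eq.symm <| D.isProduct_iff_mul_eq.1 <|
    show IsProduct _ _ _ (f • (x * y)) by
      simpa only [MulAction.one_smul, _root_.one_mul] using (D.isProduct_mul x y).smul 1 f

instance : Semigroup (D.T.sec U) where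
  mul_assoc x y z := (D.isProduct_iff_mul_eq.1 ((delta2_map_eq_kappa_iff D.τ.hom).1 D.triangle
    (D.isProduct_mul x y) (D.isProduct_mul y z) (D.isProduct_mul (x * y) z))).symm

variable (U) in
theorem existsUnique_mul_self_eq_self : ∃! e : D.T.sec U, e * e = e :=
  D.T.existsUnique_of_existsUnique_smul (1 : U ⟶ G) (fun _ _ e => e * e = e)
    (fun _ _ _ h e he => by rw [← res_mul, he])
    (fun _ g e he => by rw [comp_one, ← mul_eq_left, ← pr_mul, he])
    (fun V g t ht => by
      rw [comp_one] at ht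
      obtain ⟨k, hk⟩ := D.T.exists_smul (t := t) (t' := t * t)
        (by rw [pr_mul, ht, _root_.mul_one])
      have hmul (f : F.obj.obj (op V)) : f • t * f • t = (f * k) • f • t := by
        rw [smul_mul_smul_comm, ← hk, ← SemigroupAction.mul_smul, ← SemigroupAction.mul_smul,
          mul_right_comm]
      refine ⟨k⁻¹, ?_, fun f hf => ?_⟩
      · change k⁻¹ • t * k⁻¹ • t = k⁻¹ • t
        rw [hmul, inv_mul_cancel, MulAction.one_smul]
      · exact eq_inv_of_mul_eq_one_left (Torsor.smul_eq_self.1 ((hmul f).symm.trans hf)))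

instance : One (D.T.sec U) where
  one := (D.existsUnique_mul_self_eq_self U).choose

theorem mul_self_eq_self_iff {e : D.T.sec U} : e * e = e ↔ e = 1 :=
  have h := (D.existsUnique_mul_self_eq_self U).choose_spec
  ⟨h.2 e, fun he => he ▸ h.1⟩

theorem res_one (g : V ⟶ U) : D.T.res g (1 : D.T.sec U) = 1 := by
  rw [← mul_self_eq_self_iff, ← res_mul, D.mul_self_eq_self_iff.2 rfl]

theorem pr_one : D.T.pr (1 : D.T.sec U) = 1 := by
  rw [← mul_eq_left, ← pr_mul, D.mul_self_eq_self_iff.2 rfl]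

protected theorem mul_one (x : D.T.sec U) : x * 1 = x := by
  obtain ⟨f, hf⟩ := D.T.exists_smul (t := x) (t' := x * 1) (by rw [pr_mul, pr_one, _root_.mul_one])
  have h : f • (x * 1) = x * 1 := by
    rw [← smul_mul_assoc, hf, _root_.mul_assoc, D.mul_self_eq_self_iff.2 rfl]
  rw [← hf, Torsor.smul_eq_self.1 h, MulAction.one_smul]

theorem exists_mul_eq_one (x : D.T.sec U) : ∃ y, x * y = 1 := by
  simpa only [Torsor.res_id] using (D.T.existsUnique_of_existsUnique_smul (D.T.pr x)⁻¹
    (fun _ g y => D.T.res g x * y = 1)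
    (fun _ _ g h y hy => by rw [← Torsor.res_res, ← res_mul, hy, res_one])
    (fun _ g y hy => by
      rw [GrpObj.comp_inv, ← Torsor.pr_res, eq_inv_iff_mul_eq_one, mul_eq_one_comm, ← pr_mul, hy,
        pr_one])
    (fun _ g y hy => by
      simp_rw [mul_smul_comm]
      exact Torsor.existsUnique_smul_eq (by
        rw [pr_mul, hy, Torsor.pr_res, ← comp_mul, mul_inv_cancel, comp_one, pr_one]))).exists

instance : Inv (D.T.sec U) where
  inv x := (D.exists_mul_eq_one x).choose

instance : Group (D.T.sec U) :=
  Group.ofRightAxioms mul_assoc D.mul_one fun x => (D.exists_mul_eq_one x).choose_spec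

/-- The sheaf of groups of sections of `T`. -/
def groupSheaf : Sheaf J GrpCat.{u + 1} where
  obj :=
    { obj := fun U => GrpCat.of (D.T.sec U.unop)
      map := fun g => GrpCat.ofHom
        { toFun := D.T.res g.unop
          map_one' := D.res_one g.unop
          map_mul' := D.res_mul g.unop }
      map_id := fun U => by
        ext t
        exact D.T.res_id t
      map_comp := fun g h => by
        ext t
        exact (D.T.res_res g.unop h.unop t).symm }
  property := by
    rw [Presheaf.isSheaf_iff_isSheaf_forget J _ (CategoryTheory.forget GrpCat.{u + 1})]
    exact D.T.sheaf.property

/-- The central extension defined by an extension datum: `F` embeds as the fibre of `T` over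
`1`. -/
def toCentralExtension : CentralExtension F G where
  E := D.groupSheaf
  j {U} := MonoidHom.smulOneHom (M := F.obj.obj (op U)) (N := D.T.sec U)
  q {U} :=
    { toFun := fun x : D.T.sec U => D.T.pr x
      map_one' := D.pr_one
      map_mul' := D.pr_mul }
  j_map {U V} g f := (D.T.res_smul g f 1).trans (by rw [res_one]; rfl)
  q_map g x := D.T.pr_res g x
  j_injective {U} f f' h := D.T.smul_inj (t := 1) h
  exact {U} x := by
    refine ⟨fun h => D.T.exists_smul (D.pr_one.trans h.symm), ?_⟩
    rintro ⟨f, rfl⟩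
    exact (D.T.pr_smul f 1).trans D.pr_one
  q_locally_surjective a := D.T.local_sec a
  central {U} f x := by
    change D.T.sec U at x
    exact (smul_one_mul f x).trans (mul_smul_one f x).symm

variable {D} {D' : ExtensionDatum F G}

theorem isMultiplicative_forget_map (α : D ⟶ D') :
    IsMultiplicative (T := D.T) (T' := D'.T) ((forget F G).map α) :=
  fun _ x y => (D'.isProduct_iff_mul_eq.1 ((D.isProduct_mul x y).map (Hom.triangle α))).symm

/-- The morphism of extension data defined by a multiplicative morphism of torsors. -/
def homOfIsMultiplicative (φ : D.T ⟶ D'.T) (hφ : IsMultiplicative φ) : D ⟶ D' :=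
  have := Torsor.isIso_hom φ
  Hom.mk (asIso φ) (comp_delta1_map_eq_iff.2 fun {U x y z} hz => by
    rw [isProduct_iff_mul_eq] at hz ⊢
    exact (hφ x y).symm.trans (congrArg (app φ) hz))

instance : (forget F G).Faithful where
  map_injective h := Hom.ext (Iso.ext h)

/-- The torsor underlying the central extension of `(T, τ)` is `T`. -/
def toTorsorIso (D : ExtensionDatum F G) : D.toCentralExtension.toTorsor ≅ D.T where
  hom := Torsor.mkHom (T := D.toCentralExtension.toTorsor) (T' := D.T) (fun x => x)
    (fun _ _ => rfl) (fun _ => rfl) (fun {U} f x => smul_one_mul (N := D.T.sec U) f x)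
  inv := Torsor.mkHom (T := D.T) (T' := D.toCentralExtension.toTorsor) (fun x => x)
    (fun _ _ => rfl) (fun _ => rfl) (fun f x => (smul_one_mul f x).symm)

theorem inducesTrivialisation_toTorsorIso (D : ExtensionDatum F G) :
    D.toCentralExtension.InducesTrivialisation D D.toTorsorIso.hom :=
  fun _ x y => (D.isProduct_mul x y).2

theorem isMultiplicative_toTorsorIso_hom (D : ExtensionDatum F G) :
    IsMultiplicative D.toTorsorIso.hom :=
  fun _ _ _ => rfl

theorem isMultiplicative_toTorsorIso_inv (D : ExtensionDatum F G) :
    IsMultiplicative D.toTorsorIso.inv :=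
  fun _ _ _ => rfl

variable (F G) in
/-- The functor from extension data to central extensions. -/
def centralExtensionFunctor : ExtensionDatum F G ⥤ CentralExtension F G where
  obj D := D.toCentralExtension
  map {D D'} α := CentralExtension.homOfIsMultiplicative
    (D.toTorsorIso.hom ≫ (forget F G).map α ≫ D'.toTorsorIso.inv)
    (D.isMultiplicative_toTorsorIso_hom.comp
      ((isMultiplicative_forget_map α).comp D'.isMultiplicative_toTorsorIso_inv))
  map_id _ := (CentralExtension.torsor F G).map_injective rfl
  map_comp _ _ := (CentralExtension.torsor F G).map_injective rfl

variable (F G) in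
/-- The torsor underlying the central extension of `(T, τ)` is `T`, naturally in `(T, τ)`. -/
def centralExtensionFunctorCompTorsor :
    centralExtensionFunctor F G ⋙ CentralExtension.torsor F G ≅ forget F G :=
  NatIso.ofComponents toTorsorIso fun _ => rfl

instance : (centralExtensionFunctor F G).Faithful :=
  Functor.Faithful.of_comp_iso (centralExtensionFunctorCompTorsor F G)

instance : (centralExtensionFunctor F G).Full where
  map_surjective {D D'} β :=
    ⟨homOfIsMultiplicative
      (D.toTorsorIso.inv ≫ (CentralExtension.torsor F G).map β ≫ D'.toTorsorIso.hom)
      (D.isMultiplicative_toTorsorIso_inv.comp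
        ((CentralExtension.isMultiplicative_torsor_map β).comp
          D'.isMultiplicative_toTorsorIso_hom)),
      (CentralExtension.torsor F G).map_injective rfl⟩

end ExtensionDatum

namespace CentralExtension

variable (E : CentralExtension F G)

/-- The section `y ⊗ (x y)^∨ ⊗ x` of `δ¹ E` over the point `(q x, q y)` of `G²`. -/
def mulSec (x y : E.toTorsor.sec U) : ((delta1 F G).obj E.toTorsor).sec U :=
  delta1Sec E.toTorsor (lift (E.toTorsor.pr x) (E.toTorsor.pr y)) y (x * y) x
    (by rw [lift_snd]) (E.pr_mul x y) (by rw [lift_fst])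

theorem pr_mulSec (x y : E.toTorsor.sec U) :
    ((delta1 F G).obj E.toTorsor).pr (E.mulSec x y) =
      lift (E.toTorsor.pr x) (E.toTorsor.pr y) :=
  pr_delta1Sec ..

theorem res_mulSec (g : V ⟶ U) (x y : E.toTorsor.sec U) :
    ((delta1 F G).obj E.toTorsor).res g (E.mulSec x y) =
      E.mulSec (E.toTorsor.res g x) (E.toTorsor.res g y) :=
  (res_delta1Sec _ _ _ _ _ _ _ _ g).trans (delta1Sec_congr _ _ _
    (by rw [comp_lift, Torsor.pr_res, Torsor.pr_res]) rfl (E.res_mul g x y) rfl)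

theorem mulSec_smul_smul (f f' : F.obj.obj (op U)) (x y : E.toTorsor.sec U) :
    E.mulSec (f • x) (f' • y) = E.mulSec x y :=
  (delta1Sec_congr _ _ _ (by rw [Torsor.pr_smul, Torsor.pr_smul]) rfl
    (smul_mul_smul_comm f x f' y) rfl).trans (delta1Sec_smul_mul_smul _ _ _ _ _ _ _ _ f f')

theorem mulSec_eq_of_pr_eq {x y x' y' : E.toTorsor.sec U}
    (h : ((delta1 F G).obj E.toTorsor).pr (E.mulSec x y) =
      ((delta1 F G).obj E.toTorsor).pr (E.mulSec x' y')) :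
    E.mulSec x y = E.mulSec x' y' := by
  rw [pr_mulSec, pr_mulSec] at h
  obtain ⟨f, rfl⟩ := E.toTorsor.exists_smul (t := x) (t' := x')
    (by simpa only [lift_fst] using congrArg (· ≫ fst G G) h)
  obtain ⟨f', rfl⟩ := E.toTorsor.exists_smul (t := y) (t' := y')
    (by simpa only [lift_snd] using congrArg (· ≫ snd G G) h)
  rw [mulSec_smul_smul]

theorem exists_isProduct_mul : ∃ τ : trivial F (G ⊗ G) ≅ (delta1 F G).obj E.toTorsor,
    ∀ ⦃U : C⦄ (x y : E.toTorsor.sec U), IsProduct τ.hom x y (x * y) := by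
  obtain ⟨τ, hτ⟩ := Torsor.exists_trivialisation ((delta1 F G).obj E.toTorsor)
    (fun _ s => ∃ x y, E.mulSec x y = s)
    (by rintro U V g _ ⟨x, y, rfl⟩; exact ⟨_, _, (E.res_mulSec g x y).symm⟩)
    (by rintro U _ _ ⟨x, y, rfl⟩ ⟨x', y', rfl⟩ h; exact E.mulSec_eq_of_pr_eq h)
    (fun U a =>
      let ⟨R, hR, h⟩ := E.toTorsor.exists_local_lift_pr E.toTorsor a
      ⟨R, hR, fun V g hg =>
        let ⟨x, y, hxy⟩ := h g hg
        ⟨E.mulSec x y, ⟨x, y, rfl⟩, (E.pr_mulSec x y).trans hxy⟩⟩)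
  exact ⟨τ, fun U x y => ⟨E.pr_mul x y, .trans (by rw [pr_delta1Sec]) (hτ _ ⟨x, y, rfl⟩)⟩⟩

/-- The trivialisation `1 ↦ y ⊗ (x y)^∨ ⊗ x` of `δ¹ E` defined by the group law of `E`. -/
def trivialisation : trivial F (G ⊗ G) ≅ (delta1 F G).obj E.toTorsor :=
  E.exists_isProduct_mul.choose

theorem isProduct_trivialisation_iff {x y z : E.toTorsor.sec U} :
    IsProduct E.trivialisation.hom x y z ↔ x * y = z :=
  have h := E.exists_isProduct_mul.choose_spec x y
  ⟨fun hz => (IsProduct.existsUnique _ x y).unique h hz, fun hz => hz ▸ h⟩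

/-- The extension datum of a central extension. -/
def toExtensionDatum : ExtensionDatum F G where
  T := E.toTorsor
  τ := E.trivialisation
  triangle := (delta2_map_eq_kappa_iff _).2 fun hxy hyz hw => by
    rw [isProduct_trivialisation_iff] at hxy hyz hw ⊢
    rw [← hw, ← hxy, ← hyz, _root_.mul_assoc]

theorem isMultiplicative_toTorsorIso_toExtensionDatum :
    IsMultiplicative (T' := E.toTorsor) E.toExtensionDatum.toTorsorIso.hom := fun _ x y =>
  (E.isProduct_trivialisation_iff.1 (E.toExtensionDatum.isProduct_mul x y)).symm

/-- A central extension is isomorphic to that of its extension datum. -/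
def toExtensionDatumIso : E.toExtensionDatum.toCentralExtension ≅ E :=
  asIso (homOfIsMultiplicative (E' := E) E.toExtensionDatum.toTorsorIso.hom
    E.isMultiplicative_toTorsorIso_toExtensionDatum)

end CentralExtension

instance : (ExtensionDatum.centralExtensionFunctor F G).EssSurj where
  mem_essImage E := ⟨E.toExtensionDatum, ⟨E.toExtensionDatumIso⟩⟩

instance : (ExtensionDatum.centralExtensionFunctor F G).IsEquivalence where

end ExtData

end

theorem theorem1_general {C : Type (u + 1)} [Category.{u} C] [CartesianMonoidalCategory C]
    {J : GrothendieckTopology C} [J.Subcanonical] (F : Sheaf J CommGrpCat.{u + 1}) (G : C)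
    [GrpObj G] :
    ∃ (e : ExtData.ExtensionDatum F G ≌ ExtData.CentralExtension F G)
      (i : e.functor ⋙ ExtData.CentralExtension.torsor F G ≅ ExtData.ExtensionDatum.forget F G),
      ∀ D : ExtData.ExtensionDatum F G,
        (e.functor.obj D).InducesTrivialisation D (i.hom.app D) :=
  ⟨(ExtData.ExtensionDatum.centralExtensionFunctor F G).asEquivalence,
    ExtData.ExtensionDatum.centralExtensionFunctorCompTorsor F G,
    fun D => D.inducesTrivialisation_toTorsorIso⟩

theorem theorem1 (S : AlgebraicGeometry.Scheme.{u}) (G : Over S) [GrpObj G]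
    (F : Sheaf (ExtData.fppf S) CommGrpCat.{u + 1}) (hF : ExtData.IsRepresentableFppfAffine F) :
    ∃ (e : ExtData.ExtensionDatum F G ≌ ExtData.CentralExtension F G)
      (i : e.functor ⋙ ExtData.CentralExtension.torsor F G ≅ ExtData.ExtensionDatum.forget F G),
      ∀ D : ExtData.ExtensionDatum F G,
        (e.functor.obj D).InducesTrivialisation D (i.hom.app D) :=
  theorem1_general F G
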